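/- Conventions. All $C^*$-algebras are complex. $\mathcal K=\mathcal K(\mathcal H)$ is the $C^*$-algebra of compact operators on a separable infinite-dimensional Hilbert space $\mathcal H$, $\mathcal K^+=\mathcal K\oplus\mathbb C$ is its unitisation, and $\otimes$ is the completion of the algebraic tensor product in its $C^*$-norm (which is unique when one factor is $\mathcal K$ or $\mathcal K^+$). An ideal $A$ of $B$ (closed, two-sided) is essential if $bA=0$ with $b\in B$ implies $b=0$. Let $B\hookrightarrow\widetilde B$ be an injective $*$-homomorphism of unital $C^*$-algebras, and let a finite group $G$ act on $\widetilde B$ by $*$-automorphisms so that every $g\neq e$ acts non-trivially and $B=\widetilde B^G$. Put $\langle a,b\rangle_{\widetilde B}=\sum_{g\in G}g(a^*b)\in B$. The triple $(B,\widetilde B,G)$ is a *unital noncommutative finite-fold covering* if $\widetilde B$, with this $B$-valued product, is a finitely generated projective (right) Hilbert $B$-module. Let $A\hookrightarrow\widetilde A$ be a $*$-homomorphism of $C^*$-algebras and let $G$ be a finite group acting on $\widetilde A$ by $*$-automorphisms. The triple $(A,\widetilde A,G)$ is a *noncommutative finite-fold covering* if there are a unital noncommutative finite-fold covering $(B,\widetilde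 B,G)$ and inclusions $A\subset B$, $\widetilde A\subset\widetilde B$, compatible with $A\hookrightarrow\widetilde A$, with $B\hookrightarrow\widetilde B$ and with the actions of $G$, such that $A$ is an essential ideal of $B$, $\widetilde A$ is an essential ideal of $\widetilde B$, and $$\widetilde A=\{a\in\widetilde B\;|\;\langle \widetilde b,a\rangle_{\widetilde B}\in A\ \text{ for all } \widetilde b\in\widetilde B\}.\qquad(*)$$ In this case we say that $(B,\widetilde B,G)$ realizes $(A,\widetilde A,G)$. Theorem. If $(A,\widetilde A,G)$ is a noncommutative finite-fold covering, then $(A\otimes\mathcal K,\widetilde A\otimes\mathcal K,G)$, with the action $g\mapsto g\otimes\mathrm{id}_{\mathcal K}$ and the map $A\otimes\mathcal K\to\widetilde A\otimes\mathcal K$ induced by $A\hookrightarrow\widetilde A$, is a noncommutative finite-fold covering. More precisely, whenever a unital covering $(B,\widetilde B,G)$ realizes $(A,\widetilde A,G)$, the triple $(B\otimes\mathcal K^+,\widetilde B\otimes\mathcal K^+,G)$, with the induced maps and the action $g\mapsto g\otimes\mathrm{id}_{\mathcal K^+}$, is a unital noncommutative finite-fold covering that realizes $(A\otimes\mathcal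 K,\widetilde A\otimes\mathcal K,G)$. In particular $A\otimes\mathcal K$ and $\widetilde A\otimes\mathcal K$ are essential ideals of $B\otimes\mathcal K^+$ and $\widetilde B\otimes\mathcal K^+$, and $$\widetilde A\otimes\mathcal K=\{a\in\widetilde B\otimes\mathcal K^+\;|\;\langle \widetilde b,a\rangle_{\widetilde B\otimes\mathcal K^+}\in A\otimes\mathcal K\ \text{ for all } \widetilde b\in\widetilde B\otimes\mathcal K^+\}.$$ -/

import Mathlib

open scoped TensorProduct

universe u v w t

namespace NCCov

noncomputable section

/-! ### The C⋆-tensor product -/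

section Seminorm

variable {A : Type*} {C : Type*} [NonUnitalCStarAlgebra A] [NonUnitalCStarAlgebra C]

/-- The algebraic tensor product of two C⋆-algebras is a ⋆-ring. -/
instance instStarRingTensor : StarRing (A ⊗[ℂ] C) where
  star_add := star_add
  star_mul x y := by
    induction x with
    | zero => simp
    | add x₁ x₂ h₁ h₂ => simp only [add_mul, star_add, mul_add, h₁, h₂]
    | tmul a c =>
      induction y with
      | zero => simp
      | add y₁ y₂ h₁ h₂ => simp only [add_mul, star_add, mul_add, h₁, h₂]
      | tmul a' c' => simp

/-- C⋆-seminorms on the algebraic tensor product of two C⋆-algebras. The last condition holds for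
every C⋆-seminorm; it is listed so that the supremum below is visibly finite. -/
structure IsCStarSeminorm (p : Seminorm ℂ (A ⊗[ℂ] C)) : Prop where
  mul_le : ∀ x y, p (x * y) ≤ p x * p y
  star_mul_self : ∀ x, p (star x * x) = p x ^ 2
  tmul_le : ∀ (a : A) (c : C), p (a ⊗ₜ c) ≤ ‖a‖ * ‖c‖

lemma IsCStarSeminorm.zero : IsCStarSeminorm (0 : Seminorm ℂ (A ⊗[ℂ] C)) where
  mul_le x y := by simp
  star_mul_self x := by simp
  tmul_le a c := by simpa using by positivity

instance : Nonempty {p : Seminorm ℂ (A ⊗[ℂ] C) // IsCStarSeminorm p} := ⟨⟨0, .zero⟩⟩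

lemma IsCStarSeminorm.star_eq {p : Seminorm ℂ (A ⊗[ℂ] C)} (hp : IsCStarSeminorm p)
    (x : A ⊗[ℂ] C) : p (star x) = p x := by
  have key : ∀ y, p y ≤ p (star y) := fun y => by
    have h1 := hp.mul_le (star y) y
    rw [hp.star_mul_self] at h1
    rcases (apply_nonneg p y).eq_or_lt with h | h
    · rw [← h]; exact apply_nonneg p _
    · nlinarith
  refine le_antisymm ?_ (key x)
  simpa using key (star x)

lemma bddAbove_seminorm (x : A ⊗[ℂ] C) :
    BddAbove (Set.range fun p : {p : Seminorm ℂ (A ⊗[ℂ] C) // IsCStarSeminorm p} => p.1 x) := by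
  induction x with
  | zero => exact ⟨0, by rintro _ ⟨p, rfl⟩; simp⟩
  | tmul a c => exact ⟨‖a‖ * ‖c‖, by rintro _ ⟨p, rfl⟩; exact p.2.tmul_le a c⟩
  | add x y hx hy =>
    obtain ⟨M, hM⟩ := hx
    obtain ⟨N, hN⟩ := hy
    refine ⟨M + N, ?_⟩
    rintro _ ⟨p, rfl⟩
    exact (map_add_le_add p.1 x y).trans (add_le_add (hM ⟨p, rfl⟩) (hN ⟨p, rfl⟩))

/-- The C⋆-norm of the algebraic tensor product: the supremum of all its C⋆-seminorms. -/
def cstarNorm (x : A ⊗[ℂ] C) : ℝ :=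
  ⨆ p : {p : Seminorm ℂ (A ⊗[ℂ] C) // IsCStarSeminorm p}, p.1 x

lemma le_cstarNorm {p : Seminorm ℂ (A ⊗[ℂ] C)} (hp : IsCStarSeminorm p) (x : A ⊗[ℂ] C) :
    p x ≤ cstarNorm x :=
  le_ciSup (bddAbove_seminorm x) (⟨p, hp⟩ : {p // IsCStarSeminorm p})

lemma cstarNorm_le {x : A ⊗[ℂ] C} {M : ℝ}
    (h : ∀ p : Seminorm ℂ (A ⊗[ℂ] C), IsCStarSeminorm p → p x ≤ M) : cstarNorm x ≤ M :=
  ciSup_le fun p => h p.1 p.2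

lemma cstarNorm_nonneg (x : A ⊗[ℂ] C) : 0 ≤ cstarNorm x := le_cstarNorm .zero x

lemma cstarNorm_add_le (x y : A ⊗[ℂ] C) : cstarNorm (x + y) ≤ cstarNorm x + cstarNorm y :=
  cstarNorm_le fun p hp =>
    (map_add_le_add p x y).trans (add_le_add (le_cstarNorm hp x) (le_cstarNorm hp y))

lemma cstarNorm_smul_le (z : ℂ) (x : A ⊗[ℂ] C) : cstarNorm (z • x) ≤ ‖z‖ * cstarNorm x :=
  cstarNorm_le fun p hp => by
    rw [map_smul_eq_mul]
    exact mul_le_mul_of_nonneg_left (le_cstarNorm hp x) (norm_nonneg z)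

lemma cstarNorm_mul_le (x y : A ⊗[ℂ] C) : cstarNorm (x * y) ≤ cstarNorm x * cstarNorm y :=
  cstarNorm_le fun p hp => (hp.mul_le x y).trans
    (mul_le_mul (le_cstarNorm hp x) (le_cstarNorm hp y) (apply_nonneg p y) (cstarNorm_nonneg x))

lemma cstarNorm_star (x : A ⊗[ℂ] C) : cstarNorm (star x) = cstarNorm x := by
  unfold cstarNorm
  exact iSup_congr fun p => p.2.star_eq x

lemma cstarNorm_mul_self_le (x : A ⊗[ℂ] C) :
    cstarNorm x * cstarNorm x ≤ cstarNorm (star x * x) := by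
  have h : cstarNorm x ≤ √(cstarNorm (star x * x)) := cstarNorm_le fun p hp => by
    apply Real.le_sqrt_of_sq_le
    rw [← hp.star_mul_self]
    exact le_cstarNorm hp _
  calc cstarNorm x * cstarNorm x
      ≤ √(cstarNorm (star x * x)) * √(cstarNorm (star x * x)) :=
        mul_self_le_mul_self (cstarNorm_nonneg x) h
    _ = _ := Real.mul_self_sqrt (cstarNorm_nonneg _)

lemma cstarNorm_tmul_le (a : A) (c : C) : cstarNorm (a ⊗ₜ[ℂ] c) ≤ ‖a‖ * ‖c‖ :=
  cstarNorm_le fun _ hp => hp.tmul_le a c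

end Seminorm

section Completion

variable (A : Type*) (C : Type*) [NonUnitalCStarAlgebra A] [NonUnitalCStarAlgebra C]

/-- The algebraic tensor product, carrying its C⋆-norm. -/
def PreTensor : Type _ := A ⊗[ℂ] C

instance : NonUnitalRing (PreTensor A C) := inferInstanceAs (NonUnitalRing (A ⊗[ℂ] C))
instance : StarRing (PreTensor A C) := inferInstanceAs (StarRing (A ⊗[ℂ] C))
instance : Module ℂ (PreTensor A C) := inferInstanceAs (Module ℂ (A ⊗[ℂ] C))
instance : StarModule ℂ (PreTensor A C) := inferInstanceAs (StarModule ℂ (A ⊗[ℂ] C))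
instance : IsScalarTower ℂ (PreTensor A C) (PreTensor A C) :=
  inferInstanceAs (IsScalarTower ℂ (A ⊗[ℂ] C) (A ⊗[ℂ] C))
instance : SMulCommClass ℂ (PreTensor A C) (PreTensor A C) :=
  inferInstanceAs (SMulCommClass ℂ (A ⊗[ℂ] C) (A ⊗[ℂ] C))

/-- The C⋆-norm as a group seminorm. -/
def groupSeminorm : AddGroupSeminorm (PreTensor A C) where
  toFun := cstarNorm (A := A) (C := C)
  map_zero' := le_antisymm (cstarNorm_le fun p _ => (map_zero p).le) (cstarNorm_nonneg _)
  add_le' := cstarNorm_add_le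
  neg' x := by unfold cstarNorm; exact iSup_congr fun p => map_neg_eq_map p.1 x

/-- The elementary tensor of two elements of the algebraic tensor product. -/
def PreTensor.tmul {A C : Type*} [NonUnitalCStarAlgebra A] [NonUnitalCStarAlgebra C]
    (a : A) (c : C) : PreTensor A C := a ⊗ₜ[ℂ] c

lemma PreTensor.tmul_mul_tmul {A C : Type*} [NonUnitalCStarAlgebra A] [NonUnitalCStarAlgebra C]
    (a a' : A) (c c' : C) : tmul a c * tmul a' c' = tmul (a * a') (c * c') :=
  Algebra.TensorProduct.tmul_mul_tmul (R := ℂ) a a' c c'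

instance : SeminormedAddCommGroup (PreTensor A C) :=
  (groupSeminorm A C).toSeminormedAddCommGroup

variable {A C} in
lemma PreTensor.norm_def (x : PreTensor A C) : ‖x‖ = cstarNorm (A := A) (C := C) x := rfl

instance : NonUnitalSeminormedRing (PreTensor A C) where
  __ := (inferInstance : SeminormedAddCommGroup (PreTensor A C))
  __ := (inferInstance : NonUnitalRing (PreTensor A C))
  norm_mul_le x y := cstarNorm_mul_le (A := A) (C := C) x y

instance : NormedSpace ℂ (PreTensor A C) where
  norm_smul_le z x := cstarNorm_smul_le (A := A) (C := C) z x

instance : NormedStarGroup (PreTensor A C) where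
  norm_star_le x := (cstarNorm_star (A := A) (C := C) x).le

/-- The C⋆-tensor product of two C⋆-algebras: the completion of the algebraic tensor product in
its (largest) C⋆-norm. If one factor is nuclear (as are the algebra of compact operators and its
unitisation), this norm is the only C⋆-norm. -/
def CStarTensor : Type _ := UniformSpace.Completion (PreTensor A C)

namespace CStarTensor

open UniformSpace.Completion

instance : NormedAddCommGroup (CStarTensor A C) :=
  inferInstanceAs (NormedAddCommGroup (UniformSpace.Completion (PreTensor A C)))
instance : NormedSpace ℂ (CStarTensor A C) :=
  inferInstanceAs (NormedSpace ℂ (UniformSpace.Completion (PreTensor A C)))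
instance : CompleteSpace (CStarTensor A C) :=
  inferInstanceAs (CompleteSpace (UniformSpace.Completion (PreTensor A C)))

variable {A C}

/-- The canonical map of the algebraic tensor product to the C⋆-tensor product. -/
def incl : PreTensor A C →ₗᵢ[ℂ] CStarTensor A C := toComplₗᵢ (𝕜 := ℂ)

lemma isDenseInducing_incl : IsDenseInducing (incl : PreTensor A C → CStarTensor A C) :=
  isDenseInducing_coe

lemma induction_on {P : CStarTensor A C → Prop} (x : CStarTensor A C)
    (hc : IsClosed {x | P x}) (h : ∀ y : PreTensor A C, P (incl y)) : P x :=
  UniformSpace.Completion.induction_on x hc h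

lemma induction_on₂ {P : CStarTensor A C → CStarTensor A C → Prop} (x y : CStarTensor A C)
    (hc : IsClosed {x : CStarTensor A C × CStarTensor A C | P x.1 x.2})
    (h : ∀ x y : PreTensor A C, P (incl x) (incl y)) : P x y :=
  UniformSpace.Completion.induction_on₂ x y hc h

lemma induction_on₃ {P : CStarTensor A C → CStarTensor A C → CStarTensor A C → Prop}
    (x y z : CStarTensor A C)
    (hc : IsClosed {x : CStarTensor A C × CStarTensor A C × CStarTensor A C | P x.1 x.2.1 x.2.2})
    (h : ∀ x y z : PreTensor A C, P (incl x) (incl y) (incl z)) : P x y z :=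
  UniformSpace.Completion.induction_on₃ x y z hc h

instance : Mul (CStarTensor A C) :=
  ⟨Function.curry <| (isDenseInducing_incl.prodMap isDenseInducing_incl).extend
    (incl ∘ Function.uncurry (· * ·))⟩

instance : Star (CStarTensor A C) :=
  ⟨isDenseInducing_incl.extend fun x => incl (star x)⟩

lemma incl_mul (x y : PreTensor A C) : incl (x * y) = incl x * incl y :=
  ((isDenseInducing_incl.prodMap isDenseInducing_incl).extend_eq
    (incl.continuous.comp (continuous_mul (M := PreTensor A C))) (x, y)).symm

lemma incl_star (x : PreTensor A C) : incl (star x) = star (incl x) :=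
  (isDenseInducing_incl.extend_eq
    (incl.continuous.comp (continuous_star (R := PreTensor A C))) x).symm

instance : ContinuousMul (CStarTensor A C) where
  continuous_mul := by
    let m : PreTensor A C →+ PreTensor A C →+ CStarTensor A C :=
      (AddMonoidHom.mul : PreTensor A C →+ _ →+ _).compr₂ (toCompl (α := PreTensor A C))
    have : Continuous fun p : PreTensor A C × PreTensor A C => m p.1 p.2 :=
      (incl (A := A) (C := C)).continuous.comp (continuous_mul (M := PreTensor A C))
    have di : IsDenseInducing (toCompl : PreTensor A C → UniformSpace.Completion _) :=
      isDenseInducing_coe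
    exact (di.extend_Z_bilin di this :)

instance : ContinuousStar (CStarTensor A C) where
  continuous_star := by
    have h : UniformContinuous fun x : PreTensor A C => incl (star x) :=
      incl.isometry.uniformContinuous.comp
        (starNormedAddGroupHom (E := PreTensor A C)).uniformContinuous
    exact (uniformContinuous_uniformly_extend
      (isUniformInducing_coe (PreTensor A C)) denseRange_coe h).continuous

instance : NonUnitalNormedRing (CStarTensor A C) where
  __ := (inferInstance : NormedAddCommGroup (CStarTensor A C))
  mul_assoc x y z := by
    induction x, y, z using induction_on₃ with
    | hc => exact isClosed_eq (by fun_prop) (by fun_prop)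
    | h x y z => simp only [← incl_mul, mul_assoc]
  left_distrib x y z := by
    induction x, y, z using induction_on₃ with
    | hc => exact isClosed_eq (by fun_prop) (by fun_prop)
    | h x y z => simp only [← incl_mul, ← map_add, mul_add]
  right_distrib x y z := by
    induction x, y, z using induction_on₃ with
    | hc => exact isClosed_eq (by fun_prop) (by fun_prop)
    | h x y z => simp only [← incl_mul, ← map_add, add_mul]
  zero_mul x := by
    induction x using induction_on with
    | hc => exact isClosed_eq (by fun_prop) (by fun_prop)
    | h x => rw [← map_zero incl, ← incl_mul, zero_mul]
  mul_zero x := by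
    induction x using induction_on with
    | hc => exact isClosed_eq (by fun_prop) (by fun_prop)
    | h x => rw [← map_zero incl, ← incl_mul, mul_zero]
  norm_mul_le x y := by
    induction x, y using induction_on₂ with
    | hc => exact isClosed_le (by fun_prop) (by fun_prop)
    | h x y =>
      rw [← incl_mul]
      simp only [LinearIsometry.norm_map]
      exact norm_mul_le x y

instance : StarRing (CStarTensor A C) where
  star_involutive x := by
    induction x using induction_on with
    | hc => exact isClosed_eq (by fun_prop) (by fun_prop)
    | h x => simp only [← incl_star, star_star]
  star_mul x y := by
    induction x, y using induction_on₂ with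
    | hc => exact isClosed_eq (by fun_prop) (by fun_prop)
    | h x y => simp only [← incl_mul, ← incl_star, star_mul]
  star_add x y := by
    induction x, y using induction_on₂ with
    | hc => exact isClosed_eq (by fun_prop) (by fun_prop)
    | h x y => simp only [← map_add, ← incl_star, star_add]

instance : CStarRing (CStarTensor A C) where
  norm_mul_self_le x := by
    induction x using induction_on with
    | hc => exact isClosed_le (by fun_prop) (by fun_prop)
    | h x =>
      rw [← incl_star, ← incl_mul]
      simp only [LinearIsometry.norm_map]
      exact cstarNorm_mul_self_le (A := A) (C := C) x

variable (A C) in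
lemma continuous_smul_left (z : ℂ) : Continuous fun x : CStarTensor A C => z • x :=
  haveI : IsBoundedSMul ℂ (CStarTensor A C) := NormedSpace.toIsBoundedSMul
  continuous_const_smul z

lemma smul_mul (z : ℂ) (x y : CStarTensor A C) : z • x * y = z • (x * y) := by
  induction x, y using induction_on₂ with
  | hc =>
    exact isClosed_eq (((continuous_smul_left A C z).comp continuous_fst).mul continuous_snd)
      ((continuous_smul_left A C z).comp continuous_mul)
  | h x y => rw [← incl.map_smul, ← incl_mul, ← incl_mul, ← incl.map_smul, smul_mul_assoc]

lemma mul_smul_right (z : ℂ) (x y : CStarTensor A C) : x * z • y = z • (x * y) := by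
  induction x, y using induction_on₂ with
  | hc =>
    exact isClosed_eq (continuous_fst.mul ((continuous_smul_left A C z).comp continuous_snd))
      ((continuous_smul_left A C z).comp continuous_mul)
  | h x y => rw [← incl.map_smul, ← incl_mul, ← incl_mul, ← incl.map_smul, mul_smul_comm]

instance : NonUnitalCStarAlgebra (CStarTensor A C) where
  __ := (inferInstance : NonUnitalNormedRing (CStarTensor A C))
  __ := (inferInstance : StarRing (CStarTensor A C))
  __ := (inferInstance : CStarRing (CStarTensor A C))
  __ := (inferInstance : NormedSpace ℂ (CStarTensor A C))
  __ := (inferInstance : CompleteSpace (CStarTensor A C))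
  smul_assoc := smul_mul
  smul_comm z x y := (mul_smul_right z x y).symm
  star_smul z x := by
    induction x using induction_on with
    | hc =>
      exact isClosed_eq (continuous_star.comp (continuous_smul_left A C z))
        ((continuous_smul_left A C (star z)).comp continuous_star)
    | h x => rw [← incl.map_smul, ← incl_star, ← incl_star, ← incl.map_smul, star_smul]

/-- The elementary tensor of two elements. -/
def tmul (a : A) (c : C) : CStarTensor A C := incl (PreTensor.tmul a c)

/-- The span of the elementary tensors is dense. -/
lemma induction_tmul {P : CStarTensor A C → Prop} (x : CStarTensor A C)
    (hc : IsClosed {x | P x}) (hz : P 0) (ht : ∀ a c, P (tmul a c))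
    (ha : ∀ x y, P x → P y → P (x + y)) : P x := by
  refine induction_on x hc fun y => ?_
  refine TensorProduct.induction_on (motive := fun y : A ⊗[ℂ] C => P (incl (A := A) (C := C) y))
    y ?_ ht ?_
  · exact (map_zero (incl (A := A) (C := C))).symm ▸ hz
  · intro y z hy hz
    exact (map_add (incl (A := A) (C := C)) y z).symm ▸ ha _ _ hy hz

lemma tmul_mul_tmul (a a' : A) (c c' : C) :
    tmul a c * tmul a' c' = tmul (a * a') (c * c') := by
  simp only [tmul, ← incl_mul, PreTensor.tmul_mul_tmul]

end CStarTensor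

end Completion

section Unital

variable {B : Type*} {D : Type*} [CStarAlgebra B] [CStarAlgebra D]

lemma CStarTensor.tmul_one_mul (x : CStarTensor B D) : CStarTensor.tmul 1 1 * x = x := by
  induction x using CStarTensor.induction_tmul with
  | hc => exact isClosed_eq (by fun_prop) (by fun_prop)
  | hz => simp
  | ht a c => simp [CStarTensor.tmul_mul_tmul]
  | ha x y hx hy => rw [mul_add, hx, hy]

lemma CStarTensor.mul_tmul_one (x : CStarTensor B D) : x * CStarTensor.tmul 1 1 = x := by
  induction x using CStarTensor.induction_tmul with
  | hc => exact isClosed_eq (by fun_prop) (by fun_prop)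
  | hz => simp
  | ht a c => simp [CStarTensor.tmul_mul_tmul]
  | ha x y hx hy => rw [add_mul, hx, hy]

instance : NormedRing (CStarTensor B D) where
  __ := (inferInstance : NonUnitalNormedRing (CStarTensor B D))
  one := CStarTensor.tmul 1 1
  one_mul := CStarTensor.tmul_one_mul
  mul_one := CStarTensor.mul_tmul_one

instance : NormedAlgebra ℂ (CStarTensor B D) where
  __ := Algebra.ofModule (R := ℂ) (A := CStarTensor B D)
    CStarTensor.smul_mul CStarTensor.mul_smul_right
  norm_smul_le z x := norm_smul_le z x

/-- The C⋆-tensor product of unital C⋆-algebras is unital. -/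
instance : CStarAlgebra (CStarTensor B D) where
  __ := (inferInstance : NormedRing (CStarTensor B D))
  __ := (inferInstance : NormedAlgebra ℂ (CStarTensor B D))
  __ := (inferInstance : NonUnitalCStarAlgebra (CStarTensor B D))

lemma CStarTensor.one_def : (1 : CStarTensor B D) = CStarTensor.tmul 1 1 := rfl

end Unital

section Map

variable {A A' A'' C C' C'' : Type*} [NonUnitalCStarAlgebra A] [NonUnitalCStarAlgebra A']
  [NonUnitalCStarAlgebra A''] [NonUnitalCStarAlgebra C] [NonUnitalCStarAlgebra C']
  [NonUnitalCStarAlgebra C'']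

namespace PreTensor

/-- The algebraic tensor product of two ⋆-homomorphisms. -/
def map (f : A →⋆ₙₐ[ℂ] A') (g : C →⋆ₙₐ[ℂ] C') : A ⊗[ℂ] C →ₗ[ℂ] A' ⊗[ℂ] C' :=
  TensorProduct.map (f : A →ₗ[ℂ] A') (g : C →ₗ[ℂ] C')

lemma map_mul (f : A →⋆ₙₐ[ℂ] A') (g : C →⋆ₙₐ[ℂ] C') (x y : A ⊗[ℂ] C) :
    map f g (x * y) = map f g x * map f g y := by
  induction x with
  | zero => simp
  | add x₁ x₂ h₁ h₂ => simp only [add_mul, map_add, h₁, h₂]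
  | tmul a c =>
    induction y with
    | zero => simp
    | add y₁ y₂ h₁ h₂ => simp only [mul_add, map_add, h₁, h₂]
    | tmul a' c' => simp [map]

lemma map_star (f : A →⋆ₙₐ[ℂ] A') (g : C →⋆ₙₐ[ℂ] C') (x : A ⊗[ℂ] C) :
    map f g (star x) = star (map f g x) := by
  induction x with
  | zero => simp
  | add x₁ x₂ h₁ h₂ => simp only [star_add, map_add, h₁, h₂]
  | tmul a c => simp [map, StarHomClass.map_star]

lemma cstarNorm_map_le (f : A →⋆ₙₐ[ℂ] A') (g : C →⋆ₙₐ[ℂ] C') (x : A ⊗[ℂ] C) :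
    cstarNorm (map f g x) ≤ cstarNorm x :=
  cstarNorm_le fun p hp => by
    refine le_cstarNorm (p := p.comp (map f g)) ⟨fun x y => ?_, fun x => ?_, fun a c => ?_⟩ x
    · simp only [Seminorm.comp_apply, map_mul]
      exact hp.mul_le _ _
    · simp only [Seminorm.comp_apply, map_mul, map_star]
      exact hp.star_mul_self _
    · exact (hp.tmul_le (f a) (g c)).trans (mul_le_mul (NonUnitalStarAlgHom.norm_apply_le f a)
        (NonUnitalStarAlgHom.norm_apply_le g c) (norm_nonneg _) (norm_nonneg _))

/-- The algebraic tensor product of two ⋆-homomorphisms, as a contraction. -/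
def mapL (f : A →⋆ₙₐ[ℂ] A') (g : C →⋆ₙₐ[ℂ] C') : PreTensor A C →L[ℂ] PreTensor A' C' :=
  LinearMap.mkContinuous (E := PreTensor A C) (F := PreTensor A' C') (map f g) 1
    fun x => (cstarNorm_map_le f g x).trans_eq (one_mul _).symm

end PreTensor

namespace CStarTensor

/-- The continuous extension of `f ⊗ g` to the completions, as a function. -/
def completionMap (f : A →⋆ₙₐ[ℂ] A') (g : C →⋆ₙₐ[ℂ] C') : CStarTensor A C → CStarTensor A' C' :=
  UniformSpace.Completion.map (PreTensor.mapL f g)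

lemma continuous_completionMap (f : A →⋆ₙₐ[ℂ] A') (g : C →⋆ₙₐ[ℂ] C') :
    Continuous (completionMap f g) :=
  UniformSpace.Completion.continuous_map

lemma completionMap_incl (f : A →⋆ₙₐ[ℂ] A') (g : C →⋆ₙₐ[ℂ] C') (x : PreTensor A C) :
    completionMap f g (incl x) = incl (PreTensor.mapL f g x) :=
  UniformSpace.Completion.map_coe (PreTensor.mapL f g).uniformContinuous x

/-- The tensor product `f ⊗ g` of two ⋆-homomorphisms: the continuous extension of
`a ⊗ c ↦ f a ⊗ g c`. -/
def map (f : A →⋆ₙₐ[ℂ] A') (g : C →⋆ₙₐ[ℂ] C') : CStarTensor A C →⋆ₙₐ[ℂ] CStarTensor A' C' where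
  toFun := completionMap f g
  map_smul' z x := by
    have h := continuous_completionMap f g
    induction x using induction_on with
    | hc => exact isClosed_eq (h.comp (continuous_smul_left A C z))
              ((continuous_smul_left A' C' z).comp h)
    | h x =>
      rw [← incl.map_smul, completionMap_incl, completionMap_incl, ← incl.map_smul]
      exact congrArg incl ((PreTensor.mapL f g).map_smul z x)
  map_zero' := by
    rw [← incl.map_zero, completionMap_incl, ContinuousLinearMap.map_zero, incl.map_zero]
  map_add' x y := by
    have h := continuous_completionMap f g
    induction x, y using induction_on₂ with
    | hc => exact isClosed_eq (h.comp continuous_add)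
              ((h.comp continuous_fst).add (h.comp continuous_snd))
    | h x y =>
      rw [← incl.map_add, completionMap_incl, completionMap_incl, completionMap_incl,
        ← incl.map_add, ContinuousLinearMap.map_add]
  map_mul' x y := by
    have h := continuous_completionMap f g
    induction x, y using induction_on₂ with
    | hc => exact isClosed_eq (h.comp continuous_mul)
              ((h.comp continuous_fst).mul (h.comp continuous_snd))
    | h x y =>
      rw [← incl_mul, completionMap_incl, completionMap_incl, completionMap_incl, ← incl_mul]
      exact congrArg incl (PreTensor.map_mul f g x y)
  map_star' x := by
    have h := continuous_completionMap f g
    induction x using induction_on with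
    | hc => exact isClosed_eq (h.comp continuous_star) (continuous_star.comp h)
    | h x =>
      rw [← incl_star, completionMap_incl, completionMap_incl, ← incl_star]
      exact congrArg incl (PreTensor.map_star f g x)

lemma continuous_map (f : A →⋆ₙₐ[ℂ] A') (g : C →⋆ₙₐ[ℂ] C') : Continuous (map f g) :=
  continuous_completionMap f g

@[simp]
lemma map_tmul (f : A →⋆ₙₐ[ℂ] A') (g : C →⋆ₙₐ[ℂ] C') (a : A) (c : C) :
    map f g (tmul a c) = tmul (f a) (g c) :=
  completionMap_incl f g (PreTensor.tmul a c)

lemma map_comp_apply (f : A →⋆ₙₐ[ℂ] A') (g : C →⋆ₙₐ[ℂ] C') (f' : A' →⋆ₙₐ[ℂ] A'')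
    (g' : C' →⋆ₙₐ[ℂ] C'') (x : CStarTensor A C) :
    map f' g' (map f g x) = map (f'.comp f) (g'.comp g) x := by
  induction x using induction_tmul with
  | hc => exact isClosed_eq ((continuous_map f' g').comp (continuous_map f g)) (continuous_map _ _)
  | hz => simp only [map_zero]
  | ht a c => simp
  | ha x y hx hy => simp only [map_add, hx, hy]

lemma map_id_apply (x : CStarTensor A C) :
    map (NonUnitalStarAlgHom.id ℂ A) (NonUnitalStarAlgHom.id ℂ C) x = x := by
  induction x using induction_tmul with
  | hc => exact isClosed_eq (continuous_map _ _) continuous_id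
  | hz => simp only [map_zero]
  | ht a c => simp
  | ha x y hx hy => simp only [map_add, hx, hy]

/-- The tensor product `ρ ⊗ σ` of two unital ⋆-homomorphisms of unital C⋆-algebras. -/
def mapUnital {B B' D D' : Type*} [CStarAlgebra B] [CStarAlgebra B'] [CStarAlgebra D]
    [CStarAlgebra D'] (ρ : B →⋆ₐ[ℂ] B') (σ : D →⋆ₐ[ℂ] D') :
    CStarTensor B D →⋆ₐ[ℂ] CStarTensor B' D' where
  __ := map (ρ : B →⋆ₙₐ[ℂ] B') (σ : D →⋆ₙₐ[ℂ] D')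
  map_one' := by
    change map (ρ : B →⋆ₙₐ[ℂ] B') (σ : D →⋆ₙₐ[ℂ] D') 1 = 1
    simp [one_def]
  commutes' z := by
    change map (ρ : B →⋆ₙₐ[ℂ] B') (σ : D →⋆ₙₐ[ℂ] D') (algebraMap ℂ _ z) = algebraMap ℂ _ z
    rw [Algebra.algebraMap_eq_smul_one, Algebra.algebraMap_eq_smul_one, map_smul]
    simp [one_def]

variable {G : Type*} [Group G]

lemma mapAction_aux (α : G →* (A ≃⋆ₐ[ℂ] A)) (g h : G) (x : CStarTensor A C) :
    map (α g : A →⋆ₙₐ[ℂ] A) (NonUnitalStarAlgHom.id ℂ C)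
      (map (α h : A →⋆ₙₐ[ℂ] A) (NonUnitalStarAlgHom.id ℂ C) x) =
    map (α (g * h) : A →⋆ₙₐ[ℂ] A) (NonUnitalStarAlgHom.id ℂ C) x := by
  rw [map_comp_apply]
  congr 2
  ext a
  simp

lemma mapAction_aux_one (α : G →* (A ≃⋆ₐ[ℂ] A)) (x : CStarTensor A C) :
    map (α 1 : A →⋆ₙₐ[ℂ] A) (NonUnitalStarAlgHom.id ℂ C) x = x := by
  have h : (α 1 : A →⋆ₙₐ[ℂ] A) = NonUnitalStarAlgHom.id ℂ A := by
    ext a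
    simp
  rw [h, map_id_apply]

/-- The action `g ↦ α g ⊗ id` of a group on `A ⊗ C` induced by an action on `A`. -/
def mapAction (α : G →* (A ≃⋆ₐ[ℂ] A)) (C : Type*) [NonUnitalCStarAlgebra C] :
    G →* (CStarTensor A C ≃⋆ₐ[ℂ] CStarTensor A C) where
  toFun g :=
    { map (α g : A →⋆ₙₐ[ℂ] A) (NonUnitalStarAlgHom.id ℂ C) with
      invFun := map (α g⁻¹ : A →⋆ₙₐ[ℂ] A) (NonUnitalStarAlgHom.id ℂ C)
      left_inv := fun x => by
        refine (mapAction_aux α g⁻¹ g x).trans ?_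
        rw [inv_mul_cancel, mapAction_aux_one]
      right_inv := fun x => by
        refine (mapAction_aux α g g⁻¹ x).trans ?_
        rw [mul_inv_cancel, mapAction_aux_one] }
  map_one' := StarAlgEquiv.ext fun x => mapAction_aux_one α x
  map_mul' g h := StarAlgEquiv.ext fun x => (mapAction_aux α g h x).symm

@[simp]
lemma mapAction_tmul (α : G →* (A ≃⋆ₐ[ℂ] A)) (g : G) (a : A) (c : C) :
    mapAction α C g (tmul a c) = tmul (α g a) c :=
  map_tmul _ _ a c

end CStarTensor

end Map

section Compact

variable (H : Type*) [NormedAddCommGroup H] [InnerProductSpace ℂ H] [CompleteSpace H]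

lemma isCompactOperator_adjoint {T : H →L[ℂ] H} (hT : IsCompactOperator T) :
    IsCompactOperator ⇑(star T) := by
  have hTT : IsCompactOperator ⇑(T * star T) := hT.comp_clm (star T)
  change IsCompactOperator ⇑((star T : H →L[ℂ] H) : H →ₗ[ℂ] H)
  rw [isCompactOperator_iff_isCompact_closure_image_closedBall _ zero_lt_one]
  suffices h : TotallyBounded (⇑(star T) '' Metric.closedBall 0 1) from
    h.closure.isCompact_of_isClosed isClosed_closure
  have hb := (hTT.isCompact_closure_image_closedBall (f := ((T * star T : H →L[ℂ] H) : H →ₗ[ℂ] H))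
    1).totallyBounded.subset subset_closure
  rw [Metric.totallyBounded_iff]
  intro ε hε
  obtain ⟨u, hu, huf, hcov⟩ := Set.exists_subset_image_finite_and.1
    (Metric.finite_approx_of_totallyBounded hb (ε ^ 2 / 4) (by positivity))
  refine ⟨⇑(star T) '' u, huf.image _, ?_⟩
  rintro _ ⟨x, hx, rfl⟩
  obtain ⟨y, hy, hxy⟩ : ∃ y ∈ u, ‖(T * star T) x - (T * star T) y‖ < ε ^ 2 / 4 := by
    simpa [dist_eq_norm] using hcov (Set.mem_image_of_mem _ hx)
  refine Set.mem_biUnion (Set.mem_image_of_mem _ hy) ?_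
  rw [Metric.mem_ball, dist_eq_norm, ← map_sub]
  have hx1 : ‖x - y‖ ≤ 2 := by
    have h1 : ‖x‖ ≤ 1 := by simpa using hx
    have h2 : ‖y‖ ≤ 1 := by simpa using hu hy
    linarith [norm_sub_le x y]
  have key : ‖(star T) (x - y)‖ ^ 2 ≤ ‖(T * star T) (x - y)‖ * ‖x - y‖ := by
    have h := ContinuousLinearMap.apply_norm_sq_eq_inner_adjoint_left (𝕜 := ℂ) (star T) (x - y)
    rw [h]
    refine (RCLike.re_le_norm _).trans ((norm_inner_le_norm _ _).trans_eq ?_)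
    rw [← ContinuousLinearMap.star_eq_adjoint, star_star]
    rfl
  rw [← map_sub] at hxy
  refine lt_of_pow_lt_pow_left₀ 2 hε.le ?_
  nlinarith [norm_nonneg (x - y), norm_nonneg ((T * star T) (x - y))]

/-- The C⋆-algebra of compact operators on a Hilbert space. -/
def compacts : NonUnitalStarSubalgebra ℂ (H →L[ℂ] H) where
  carrier := {T | IsCompactOperator T}
  add_mem' hS hT := hS.add hT
  zero_mem' := isCompactOperator_zero
  smul_mem' z _ hT := hT.smul z
  mul_mem' {_ T} hS _ := hS.comp_clm T
  star_mem' hT := isCompactOperator_adjoint H hT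

instance : IsClosed (compacts H : Set (H →L[ℂ] H)) :=
  isClosed_setOfPred_isCompactOperator

end Compact

/-! ### Noncommutative finite-fold coverings -/

section Covering

/-- The right module structure `x · b = x ρ(b)` that a unital ⋆-homomorphism `ρ : B → B'` puts
on `B'`. -/
abbrev rightModule {B B' : Type*} [CStarAlgebra B] [CStarAlgebra B'] (ρ : B →⋆ₐ[ℂ] B') :
    Module Bᵐᵒᵖ B' :=
  Module.compHom B' (RingHom.op (ρ : B →+* B'))

/-- The product `⟨a, b⟩ = ∑ g, g (a* b)` of a C⋆-algebra with an action of a finite group. -/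
def covInner {B' G : Type*} [NonUnitalCStarAlgebra B'] [Group G] [Fintype G]
    (β : G →* (B' ≃⋆ₐ[ℂ] B')) (a b : B') : B' :=
  ∑ g, β g (star a * b)

/-- `(B, B', G)` is a unital noncommutative finite-fold covering: `ρ : B → B'` is an injective
⋆-homomorphism of unital C⋆-algebras and `β` is a non-degenerate action of the finite group `G` on
`B'` by ⋆-automorphisms, whose fixed-point algebra is `B`, such that `B'` is a finitely generated
projective right `B`-module. (The values of `covInner β` are fixed by `β`, hence lie in `B`, and
`covInner β a a ≥ star a * a`, so that `B'` is a Hilbert `B`-module in a norm that is equivalent to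
its C⋆-norm.) -/
structure IsUnitalFiniteFoldCovering {B B' G : Type*} [CStarAlgebra B] [CStarAlgebra B'] [Group G]
    (ρ : B →⋆ₐ[ℂ] B') (β : G →* (B' ≃⋆ₐ[ℂ] B')) : Prop where
  injective : Function.Injective ρ
  nondegenerate : ∀ g : G, g ≠ 1 → ∃ b : B', β g b ≠ b
  range_eq : Set.range ρ = {b : B' | ∀ g : G, β g b = b}
  finite : letI := rightModule ρ; Module.Finite Bᵐᵒᵖ B'
  projective : letI := rightModule ρ; Module.Projective Bᵐᵒᵖ B'

/-- `i` identifies `A` with an essential (closed, two-sided) ideal of `B`. (The range of an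
injective ⋆-homomorphism of C⋆-algebras is closed.) -/
structure IsEssentialIdeal {A B : Type*} [NonUnitalCStarAlgebra A] [NonUnitalCStarAlgebra B]
    (i : A →⋆ₙₐ[ℂ] B) : Prop where
  injective : Function.Injective i
  mul_mem_left : ∀ (b : B) (a : A), b * i a ∈ Set.range i
  mul_mem_right : ∀ (a : A) (b : B), i a * b ∈ Set.range i
  essential : ∀ b : B, (∀ a : A, b * i a = 0) → b = 0

/-- The unital covering `(B, B', G)`, given by `ρ` and `β`, with inclusions `i : A → B` and
`j : A' → B'`, exhibits `(A, A', G)`, given by `π : A → A'` and the action `α` on `A'`, as a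
noncommutative finite-fold covering. -/
structure IsCoveringVia {A A' B B' G : Type*} [NonUnitalCStarAlgebra A] [NonUnitalCStarAlgebra A']
    [CStarAlgebra B] [CStarAlgebra B'] [Group G] [Fintype G]
    (π : A →⋆ₙₐ[ℂ] A') (α : G →* (A' ≃⋆ₐ[ℂ] A'))
    (i : A →⋆ₙₐ[ℂ] B) (j : A' →⋆ₙₐ[ℂ] B')
    (ρ : B →⋆ₐ[ℂ] B') (β : G →* (B' ≃⋆ₐ[ℂ] B')) : Prop where
  compatible : ∀ a : A, j (π a) = ρ (i a)
  equivariant : ∀ (g : G) (x : A'), j (α g x) = β g (j x)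
  essential_base : IsEssentialIdeal i
  essential_total : IsEssentialIdeal j
  covering : IsUnitalFiniteFoldCovering ρ β
  range_eq : Set.range j = {x : B' | ∀ y : B', ∃ a : A, covInner β y x = ρ (i a)}

/-- `(A, A', G)`, given by the inclusion `π : A → A'` and the action `α` of the finite group `G` on
`A'`, is a noncommutative finite-fold covering. (An algebra that has `A` as an essential ideal
embeds into the multiplier algebra of `A`, so the universes of `B` and `B'` are no restriction.) -/
def IsFiniteFoldCovering {A : Type u} {A' : Type v} {G : Type w} [NonUnitalCStarAlgebra A]
    [NonUnitalCStarAlgebra A'] [Group G] [Fintype G]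
    (π : A →⋆ₙₐ[ℂ] A') (α : G →* (A' ≃⋆ₐ[ℂ] A')) : Prop :=
  ∃ (B : Type u) (B' : Type v) (_ : CStarAlgebra B) (_ : CStarAlgebra B')
    (i : A →⋆ₙₐ[ℂ] B) (j : A' →⋆ₙₐ[ℂ] B') (ρ : B →⋆ₐ[ℂ] B') (β : G →* (B' ≃⋆ₐ[ℂ] B')),
    IsCoveringVia π α i j ρ β

end Covering

section Stable

variable (H : Type*) [NormedAddCommGroup H] [InnerProductSpace ℂ H] [CompleteSpace H]

/-- The unitisation `K⁺ = K ⊕ ℂ` of the algebra `K` of compact operators. -/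
abbrev compactsUnit : Type _ := Unitization ℂ (compacts H)

/-- `f ⊗ id : A ⊗ K → A' ⊗ K`. -/
abbrev stab {A A' : Type*} [NonUnitalCStarAlgebra A] [NonUnitalCStarAlgebra A']
    (f : A →⋆ₙₐ[ℂ] A') : CStarTensor A (compacts H) →⋆ₙₐ[ℂ] CStarTensor A' (compacts H) :=
  CStarTensor.map f (NonUnitalStarAlgHom.id ℂ (compacts H))

/-- `i ⊗ ι : A ⊗ K → B ⊗ K⁺`, where `ι : K → K⁺` is the inclusion. -/
abbrev stabIncl {A B : Type*} [NonUnitalCStarAlgebra A] [CStarAlgebra B] (i : A →⋆ₙₐ[ℂ] B) :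
    CStarTensor A (compacts H) →⋆ₙₐ[ℂ] CStarTensor B (compactsUnit H) :=
  CStarTensor.map i (Unitization.inrNonUnitalStarAlgHom ℂ (compacts H))

/-- `ρ ⊗ id : B ⊗ K⁺ → B' ⊗ K⁺`. -/
abbrev stabUnital {B B' : Type*} [CStarAlgebra B] [CStarAlgebra B'] (ρ : B →⋆ₐ[ℂ] B') :
    CStarTensor B (compactsUnit H) →⋆ₐ[ℂ] CStarTensor B' (compactsUnit H) :=
  CStarTensor.mapUnital ρ (StarAlgHom.id ℂ (compactsUnit H))

end Stable

end

end NCCov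

/-!
Let `H` be infinite-dimensional, `K` the compact operators on `H` and `K⁺` the unitisation.

*Slice maps.* For vectors `v, w` of `H` the functional `⟨v, · w⟩` on `K⁺` induces a bounded slice
map `slice v w : A ⊗ K⁺ → A` (`CStarTensor.norm_slice_le`). As the norm of `A ⊗ K⁺` is the supremum
of all C⋆-seminorms of the algebraic tensor product, it is enough to exhibit one C⋆-seminorm that
controls the slices: the operator seminorm of the action on the Hilbert `A`-module `A ⊗ H`
(`isCStarSeminorm_sliceOpSeminorm`, `norm_algSlice_le`).

*Slices separate points.* If all slices of `x ∈ A ⊗ K` vanish, then `z x z' = 0` for all elementary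
tensors `z, z'` of finite rank, hence for all `z, z' ∈ A ⊗ K` since finite-rank operators are dense
in `K`; in particular `x* x x* = 0` and `x = 0`. An element of `A ⊗ K⁺` is the sum of an element of
`A ⊗ K`, whose slices tend to `0` along an orthonormal sequence, and of some `a ⊗ 1`, whose slices
at unit vectors are all equal to `a`; so slices separate the points of `A ⊗ K⁺` as well
(`CStarTensor.eq_zero_of_slice_eq_zero`). Slices are natural in `A`, so tensoring with `K` or `K⁺`
preserves injectivity; injective ⋆-homomorphisms are isometric, so that their ranges are closed and
can be tested on elementary tensors. Essentiality of an ideal is inherited slice by slice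
(`CStarTensor.isEssentialIdeal_stabIncl`).

*Frames.* A finitely generated `B'` has a finite frame: there are `e k, f k ∈ B'` with
`x = ∑ k, e k ⟨f k, x⟩` for all `x` (`IsUnitalFiniteFoldCovering.exists_frame`). Indeed, for a
finite set of generators `e`, the frame operator `S x = ∑ k, e k ⟨e k, x⟩` is bounded below by the
open mapping theorem, as is `S + t` for `t ≥ 0`, so `S` is invertible by continuation in `t`, and
`f k = S⁻¹ e k` will do. The elements `e k ⊗ 1` and `f k ⊗ 1` then form a frame of `B' ⊗ K⁺`
(`CStarTensor.frame_tmul_one`). It makes `B' ⊗ K⁺` finitely generated projective over `B ⊗ K⁺`, and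
it shows that an `x` with all `⟨y, x⟩` in `A ⊗ K` lies in the ideal `A' ⊗ K`.
-/

namespace NCCov

open scoped CStarAlgebra

/-! ### Positivity of Gram sums -/

section Gram

open Matrix
open scoped ComplexOrder

variable {A : Type*} [NonUnitalCStarAlgebra A] {ι : Type*} [Fintype ι]

/-- A positive semidefinite matrix factors as `Nᴴ * N`, which writes the associated `A`-valued
form as a sum of squares. -/
lemma exists_sum_star_mul_of_posSemidef {M : Matrix ι ι ℂ} (hM : M.PosSemidef) :
    ∃ N : Matrix ι ι ℂ, ∀ a : ι → A,
      ∑ i, ∑ j, M i j • (star (a i) * a j) =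
        ∑ k, star (∑ j, N k j • a j) * (∑ j, N k j • a j) := by
  classical
  obtain ⟨N, rfl⟩ : ∃ N : Matrix ι ι ℂ, M = Nᴴ * N := by
    open scoped MatrixOrder Matrix.Norms.L2Operator in
    exact CStarAlgebra.nonneg_iff_eq_star_mul_self.mp hM.nonneg
  refine ⟨N, fun a => ?_⟩
  simp only [Matrix.mul_apply, conjTranspose_apply, Finset.sum_smul, star_sum, star_smul,
    Finset.sum_mul_sum, smul_mul_smul_comm]
  rw [Finset.sum_congr rfl fun j _ => Finset.sum_comm, Finset.sum_comm]

variable [PartialOrder A] [StarOrderedRing A]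

lemma sum_smul_star_mul_nonneg {M : Matrix ι ι ℂ} (hM : M.PosSemidef) (a : ι → A) :
    0 ≤ ∑ i, ∑ j, M i j • (star (a i) * a j) := by
  obtain ⟨N, hN⟩ := exists_sum_star_mul_of_posSemidef (A := A) hM
  rw [hN]
  exact Finset.sum_nonneg fun k _ => star_mul_self_nonneg _

lemma sum_smul_star_mul_mul_le {M : Matrix ι ι ℂ} (hM : M.PosSemidef) (a : ι → A) (b : A) :
    ∑ i, ∑ j, M i j • (star (b * a i) * (b * a j)) ≤
      (‖b‖ ^ 2) • ∑ i, ∑ j, M i j • (star (a i) * a j) := by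
  obtain ⟨N, hN⟩ := exists_sum_star_mul_of_posSemidef (A := A) hM
  rw [hN, hN, Finset.smul_sum]
  refine Finset.sum_le_sum fun k _ => ?_
  simp only [← mul_smul_comm, ← Finset.mul_sum]
  rw [star_mul, mul_assoc, ← mul_assoc (star b), ← mul_assoc, sq, ← CStarRing.norm_star_mul_self,
    mul_smul_comm]
  exact CStarAlgebra.star_left_conjugate_le_norm_smul (.star_mul_self b)

variable {H : Type*} [NormedAddCommGroup H] [InnerProductSpace ℂ H]

/-- The associated quadratic form is `‖T‖² ‖ξ‖² - ‖T ξ‖²` with `ξ = ∑ i, x i • h i`. -/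
lemma posSemidef_norm_sq_smul_gram_sub (T : H →L[ℂ] H) (h : ι → H) :
    (((‖T‖ ^ 2 : ℝ) : ℂ) • gram ℂ h - gram ℂ fun i => T (h i)).PosSemidef := by
  refine .of_dotProduct_mulVec_nonneg
    (((isHermitian_gram ℂ h).smul (by simp [IsSelfAdjoint])).sub (isHermitian_gram ℂ _))
    fun x => ?_
  rw [sub_mulVec, dotProduct_sub, smul_mulVec, dotProduct_smul, star_dotProduct_gram_mulVec,
    star_dotProduct_gram_mulVec]
  simp only [← map_smul, ← map_sum, inner_self_eq_norm_sq_to_K, smul_eq_mul, sub_nonneg]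
  have := T.le_opNorm (∑ i, x i • h i)
  have h2 := pow_le_pow_left₀ (norm_nonneg _) this 2
  rw [mul_pow] at h2
  simp only [Complex.coe_algebraMap, ← Complex.ofReal_pow, ← Complex.ofReal_mul,
    Complex.real_le_real]
  exact h2

/-- The operator `b ⊗ T` on the Hilbert `A`-module `A ⊗ H` is bounded by `‖b‖ ‖T‖`. -/
lemma sum_inner_smul_star_mul_le (T : H →L[ℂ] H) (h : ι → H) (a : ι → A) (b : A) :
    ∑ i, ∑ j, inner ℂ (T (h i)) (T (h j)) • (star (b * a i) * (b * a j)) ≤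
      (‖b‖ ^ 2 * ‖T‖ ^ 2) • ∑ i, ∑ j, inner ℂ (h i) (h j) • (star (a i) * a j) := by
  refine (sum_smul_star_mul_mul_le (posSemidef_gram ℂ fun i => T (h i)) a b).trans ?_
  rw [mul_smul]
  refine smul_le_smul_of_nonneg_left ?_ (by positivity)
  have := sum_smul_star_mul_nonneg (posSemidef_norm_sq_smul_gram_sub T h) a
  simp only [Matrix.sub_apply, Matrix.smul_apply, gram_apply, sub_smul, Finset.sum_sub_distrib,
    sub_nonneg, smul_assoc, ← Finset.smul_sum, Complex.coe_smul] at this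
  simpa only [gram_apply] using this

end Gram

/-! ### A C⋆-seminorm from a representation of the second factor -/

section Slice

variable {A C H : Type*} [NonUnitalCStarAlgebra A] [NonUnitalCStarAlgebra C]
  [NormedAddCommGroup H] [InnerProductSpace ℂ H] [CompleteSpace H]

/-- The slice map `id ⊗ φ` of a linear functional `φ` on the algebraic tensor product. -/
noncomputable def algSlice (φ : C →ₗ[ℂ] ℂ) : A ⊗[ℂ] C →ₗ[ℂ] A :=
  (TensorProduct.rid ℂ A).toLinearMap ∘ₗ φ.lTensor A

@[simp]
lemma algSlice_tmul (φ : C →ₗ[ℂ] ℂ) (a : A) (c : C) : algSlice φ (a ⊗ₜ[ℂ] c) = φ c • a := by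
  simp [algSlice]

/-- The functional `c ↦ ⟨v, θ(c) w⟩` given by two vectors and a representation `θ`. -/
noncomputable def vectorFunctional (θ : C →⋆ₙₐ[ℂ] (H →L[ℂ] H)) (v w : H) : C →ₗ[ℂ] ℂ where
  toFun c := inner ℂ v (θ c w)
  map_add' c d := by simp
  map_smul' z c := by simp

@[simp]
lemma vectorFunctional_apply (θ : C →⋆ₙₐ[ℂ] (H →L[ℂ] H)) (v w : H) (c : C) :
    vectorFunctional θ v w c = inner ℂ v (θ c w) := rfl

/-- The `A`-valued semi-inner product `(id ⊗ ω)(y* z)` on `A ⊗ C`, where `ω` is the vector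
functional of `u`. On elementary tensors it is `⟨θ(c) u, θ(d) u⟩ a* b`, so that it is the inner
product of the Hilbert `A`-module `A ⊗ H`, pulled back along `a ⊗ c ↦ a ⊗ θ(c) u`. -/
noncomputable def sliceInner (θ : C →⋆ₙₐ[ℂ] (H →L[ℂ] H)) (u : H) (y z : A ⊗[ℂ] C) : A :=
  algSlice (vectorFunctional θ u u) (star y * z)

variable (θ : C →⋆ₙₐ[ℂ] (H →L[ℂ] H)) (u : H)

lemma sliceInner_add_right (x y z : A ⊗[ℂ] C) :
    sliceInner θ u x (y + z) = sliceInner θ u x y + sliceInner θ u x z := by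
  simp [sliceInner, mul_add]

lemma sliceInner_add_left (x y z : A ⊗[ℂ] C) :
    sliceInner θ u (x + y) z = sliceInner θ u x z + sliceInner θ u y z := by
  simp [sliceInner, add_mul]

lemma sliceInner_sub_right (x y z : A ⊗[ℂ] C) :
    sliceInner θ u x (y - z) = sliceInner θ u x y - sliceInner θ u x z := by
  simp [sliceInner, mul_sub]

lemma sliceInner_sub_left (x y z : A ⊗[ℂ] C) :
    sliceInner θ u (x - y) z = sliceInner θ u x z - sliceInner θ u y z := by
  simp [sliceInner, sub_mul]

lemma sliceInner_smul_right (t : ℂ) (y z : A ⊗[ℂ] C) :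
    sliceInner θ u y (t • z) = t • sliceInner θ u y z := by
  rw [sliceInner, mul_smul_comm, map_smul, sliceInner]

lemma sliceInner_smul_left (t : ℂ) (y z : A ⊗[ℂ] C) :
    sliceInner θ u (t • y) z = star t • sliceInner θ u y z := by
  simp [sliceInner, smul_mul_assoc]

lemma sliceInner_mul_right (x y z : A ⊗[ℂ] C) :
    sliceInner θ u y (x * z) = sliceInner θ u (star x * y) z := by
  simp [sliceInner, mul_assoc]

lemma inner_map_star_mul (c d : C) :
    inner ℂ u (θ (star c * d) u) = inner ℂ (θ c u) (θ d u) := by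
  rw [map_mul, map_star, mul_apply_eq_comp, ContinuousLinearMap.star_eq_adjoint,
    ContinuousLinearMap.adjoint_inner_right]

lemma sliceInner_tmul_tmul (a b : A) (c d : C) :
    sliceInner θ u (a ⊗ₜ[ℂ] c) (b ⊗ₜ[ℂ] d) = inner ℂ (θ c u) (θ d u) • (star a * b) := by
  rw [← inner_map_star_mul]
  simp [sliceInner]

lemma star_sliceInner (y z : A ⊗[ℂ] C) : star (sliceInner θ u y z) = sliceInner θ u z y := by
  induction y with
  | zero => simp [sliceInner]
  | add y₁ y₂ h₁ h₂ => simp only [sliceInner_add_left, sliceInner_add_right, star_add, h₁, h₂]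
  | tmul a c =>
    induction z with
    | zero => simp [sliceInner]
    | add y₁ y₂ h₁ h₂ => simp only [sliceInner_add_left, sliceInner_add_right, star_add, h₁, h₂]
    | tmul b d => simp [sliceInner_tmul_tmul]

/-- The right action of `A` on the first factor of `A ⊗ C`. -/
noncomputable def mulRightFst (a : A) : A ⊗[ℂ] C →ₗ[ℂ] A ⊗[ℂ] C :=
  (LinearMap.mulRight ℂ a).rTensor C

lemma sliceInner_mulRightFst_right (a : A) (y z : A ⊗[ℂ] C) :
    sliceInner θ u y (mulRightFst a z) = sliceInner θ u y z * a := by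
  induction z with
  | zero => simp [sliceInner]
  | add y₁ y₂ h₁ h₂ => simp only [map_add, sliceInner_add_right, add_mul, h₁, h₂]
  | tmul b d =>
    induction y with
    | zero => simp [sliceInner]
    | add y₁ y₂ h₁ h₂ => simp only [sliceInner_add_left, add_mul, h₁, h₂]
    | tmul a c => simp [mulRightFst, sliceInner_tmul_tmul, mul_assoc, smul_mul_assoc]

lemma sliceInner_mulRightFst_left (a : A) (y z : A ⊗[ℂ] C) :
    sliceInner θ u (mulRightFst a y) z = star a * sliceInner θ u y z := by
  rw [← star_sliceInner, sliceInner_mulRightFst_right, star_mul, star_sliceInner]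

lemma sliceInner_sum_sum {ι : Type*} [Fintype ι] (a : ι → A) (c : ι → C) :
    sliceInner θ u (∑ i, a i ⊗ₜ[ℂ] c i) (∑ i, a i ⊗ₜ[ℂ] c i) =
      ∑ i, ∑ j, inner ℂ (θ (c i) u) (θ (c j) u) • (star (a i) * a j) := by
  simp_rw [← sliceInner_tmul_tmul, sliceInner, star_sum, Finset.sum_mul_sum, map_sum]

section Order

variable [PartialOrder A] [StarOrderedRing A]

lemma sliceInner_self_nonneg (y : A ⊗[ℂ] C) : 0 ≤ sliceInner θ u y y := by
  obtain ⟨n, a, c, rfl⟩ := TensorProduct.exists_sum_tmul_eq y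
  rw [sliceInner_sum_sum]
  exact sum_smul_star_mul_nonneg (Matrix.posSemidef_gram ℂ fun i => θ (c i) u) a

lemma sliceInner_tmul_mul_self_le (a : A) (c : C) (y : A ⊗[ℂ] C) :
    sliceInner θ u (a ⊗ₜ[ℂ] c * y) (a ⊗ₜ[ℂ] c * y) ≤
      (‖a‖ * ‖c‖) ^ 2 • sliceInner θ u y y := by
  obtain ⟨n, b, d, rfl⟩ := TensorProduct.exists_sum_tmul_eq y
  simp only [Finset.mul_sum, Algebra.TensorProduct.tmul_mul_tmul]
  rw [sliceInner_sum_sum, sliceInner_sum_sum]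
  have := sum_inner_smul_star_mul_le (θ c) (fun i => θ (d i) u) b a
  simp only [map_mul, mul_apply_eq_comp]
  refine this.trans (smul_le_smul_of_nonneg_right ?_ ?_)
  · rw [mul_pow]
    gcongr
    exact NonUnitalStarAlgHom.norm_apply_le θ c
  · exact sum_smul_star_mul_nonneg (Matrix.posSemidef_gram ℂ fun i => θ (d i) u) b

end Order

/-- The Cauchy–Schwarz inequality for `sliceInner`. -/
lemma norm_sliceInner_sq_le (y z : A ⊗[ℂ] C) :
    ‖sliceInner θ u y z‖ ^ 2 ≤ ‖sliceInner θ u y y‖ * ‖sliceInner θ u z z‖ := by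
  let _ := CStarAlgebra.spectralOrder A
  have _ := CStarAlgebra.spectralOrderedRing A
  set s := sliceInner θ u y z with hs
  set N := ‖sliceInner θ u y y‖ with hN
  -- positivity of the square of `z - y · (t s)`
  have key (t : ℝ) (ht : t * N ≤ 2) (ht0 : 0 ≤ t) :
      (2 * t - t ^ 2 * N) * ‖s‖ ^ 2 ≤ ‖sliceInner θ u z z‖ := by
    have h0 := sliceInner_self_nonneg θ u (z - mulRightFst (t • s) y)
    have hzy : sliceInner θ u z y = star s := (star_sliceInner θ u y z).symm
    have hst : star (t • s) = t • star s := by simp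
    simp only [sliceInner_sub_left, sliceInner_sub_right, sliceInner_mulRightFst_left,
      sliceInner_mulRightFst_right, hst, ← hs, hzy, sub_mul,
      smul_mul_assoc, mul_smul_comm, mul_assoc] at h0
    have h1 : star s * (sliceInner θ u y y * s) ≤ N • (star s * s) := by
      rw [← mul_assoc]
      exact CStarAlgebra.star_left_conjugate_le_norm_smul (star_sliceInner θ u y y)
    have h2 : (2 * t - t ^ 2 * N) • (star s * s) ≤ sliceInner θ u z z := by
      have h3 := smul_le_smul_of_nonneg_left h1 (sq_nonneg t)
      have : (2 * t - t ^ 2 * N) • (star s * s) = t • (star s * s) + t • (star s * s)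
          - t ^ 2 • (N • (star s * s)) := by module
      rw [this]
      have h4 := add_nonneg h0 (sub_nonneg.2 h3)
      rw [← sub_nonneg]
      convert h4 using 1
      module
    have h5 : 0 ≤ 2 * t - t ^ 2 * N := by nlinarith
    have h6 := CStarAlgebra.norm_le_norm_of_nonneg_of_le
      (smul_nonneg h5 (star_mul_self_nonneg s)) h2
    rwa [norm_smul, CStarRing.norm_star_mul_self, Real.norm_of_nonneg h5, ← sq] at h6
  rcases (norm_nonneg (sliceInner θ u y y)).eq_or_lt with h | h
  · rw [← hN] at h
    rw [← h, zero_mul]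
    by_contra! hlt
    -- when `N = 0` the parameter is unconstrained, and a large value contradicts `0 < ‖s‖ ^ 2`
    have h7 := key ((‖sliceInner θ u z z‖ + 1) / ‖s‖ ^ 2) (by rw [← h]; simp) (by positivity)
    rw [← h, mul_zero, sub_zero, mul_assoc, div_mul_cancel₀ _ hlt.ne'] at h7
    linarith [norm_nonneg (sliceInner θ u z z)]
  · rw [← hN] at h
    -- the optimal parameter
    have := key (1 / N) (by field_simp; norm_num) (by positivity)
    field_simp at this
    linarith

end Slice

section SliceSpace

variable {A C H : Type*} [NonUnitalCStarAlgebra A] [NonUnitalCStarAlgebra C]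
  [NormedAddCommGroup H] [InnerProductSpace ℂ H] [CompleteSpace H]

/-- The seminorm on `A ⊗ C` of the semi-inner product `sliceInner`. -/
noncomputable def sliceSeminorm (θ : C →⋆ₙₐ[ℂ] (H →L[ℂ] H)) (u : H) : Seminorm ℂ (A ⊗[ℂ] C) :=
  Seminorm.of (fun y => √‖sliceInner θ u y y‖)
    (fun y z => by
      have hyz : ‖sliceInner θ u y z‖ ≤ √‖sliceInner θ u y y‖ * √‖sliceInner θ u z z‖ := by
        rw [← Real.sqrt_mul (norm_nonneg _)]
        exact Real.le_sqrt_of_sq_le (norm_sliceInner_sq_le θ u y z)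
      refine Real.sqrt_le_iff.2 ⟨by positivity, ?_⟩
      rw [sliceInner_add_left, sliceInner_add_right, sliceInner_add_right,
        ← star_sliceInner θ u y z]
      refine (norm_add_le _ _).trans ((add_le_add (norm_add_le _ _) (norm_add_le _ _)).trans ?_)
      rw [norm_star, add_sq, Real.sq_sqrt (norm_nonneg _), Real.sq_sqrt (norm_nonneg _)]
      linarith)
    (fun t y => by
      rw [sliceInner_smul_left, sliceInner_smul_right, norm_smul, norm_smul, norm_star,
        ← mul_assoc, Real.sqrt_mul (by positivity), Real.sqrt_mul_self (norm_nonneg _)])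

lemma sliceSeminorm_apply (θ : C →⋆ₙₐ[ℂ] (H →L[ℂ] H)) (u : H) (y : A ⊗[ℂ] C) :
    sliceSeminorm θ u y = √‖sliceInner θ u y y‖ := rfl

lemma norm_sliceInner_le (θ : C →⋆ₙₐ[ℂ] (H →L[ℂ] H)) (u : H) (y z : A ⊗[ℂ] C) :
    ‖sliceInner θ u y z‖ ≤ sliceSeminorm θ u y * sliceSeminorm θ u z := by
  rw [sliceSeminorm_apply, sliceSeminorm_apply, ← Real.sqrt_mul (norm_nonneg _)]
  exact Real.le_sqrt_of_sq_le (norm_sliceInner_sq_le θ u y z)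

lemma sliceSeminorm_tmul (θ : C →⋆ₙₐ[ℂ] (H →L[ℂ] H)) (u : H) (a : A) (c : C) :
    sliceSeminorm θ u (a ⊗ₜ[ℂ] c) = ‖a‖ * ‖θ c u‖ := by
  rw [sliceSeminorm_apply, sliceInner_tmul_tmul, norm_smul, CStarRing.norm_star_mul_self,
    inner_self_eq_norm_sq_to_K, norm_pow, RCLike.norm_ofReal, abs_norm, ← sq, ← mul_pow,
    Real.sqrt_sq (by positivity), mul_comm]

lemma sliceSeminorm_tmul_mul_le (θ : C →⋆ₙₐ[ℂ] (H →L[ℂ] H)) (u : H) (a : A) (c : C)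
    (y : A ⊗[ℂ] C) :
    sliceSeminorm θ u (a ⊗ₜ[ℂ] c * y) ≤ ‖a‖ * ‖c‖ * sliceSeminorm θ u y := by
  let _ := CStarAlgebra.spectralOrder A
  have _ := CStarAlgebra.spectralOrderedRing A
  have h := CStarAlgebra.norm_le_norm_of_nonneg_of_le (sliceInner_self_nonneg θ u _)
    (sliceInner_tmul_mul_self_le θ u a c y)
  rw [norm_smul, Real.norm_of_nonneg (by positivity)] at h
  rw [sliceSeminorm_apply, sliceSeminorm_apply]
  refine (Real.sqrt_le_sqrt h).trans_eq ?_
  rw [Real.sqrt_mul (by positivity), Real.sqrt_sq (by positivity)]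

lemma exists_sliceSeminorm_mul_le (θ : C →⋆ₙₐ[ℂ] (H →L[ℂ] H)) (u : H) (x : A ⊗[ℂ] C) :
    ∃ M, ∀ y : A ⊗[ℂ] C, sliceSeminorm θ u (x * y) ≤ M * sliceSeminorm θ u y := by
  induction x with
  | zero => exact ⟨0, fun y => by simp⟩
  | tmul a c => exact ⟨_, sliceSeminorm_tmul_mul_le θ u a c⟩
  | add x y hx hy =>
    obtain ⟨M, hM⟩ := hx
    obtain ⟨N, hN⟩ := hy
    refine ⟨M + N, fun z => ?_⟩
    rw [add_mul, add_mul]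
    exact (map_add_le_add _ _ _).trans (add_le_add (hM z) (hN z))

/-- The vector space `A ⊗ C` with the seminorm `sliceSeminorm θ u`. -/
def SliceSpace (A : Type*) [NonUnitalCStarAlgebra A] (_ : C →⋆ₙₐ[ℂ] (H →L[ℂ] H)) (_ : H) :
    Type _ := A ⊗[ℂ] C

variable (θ : C →⋆ₙₐ[ℂ] (H →L[ℂ] H)) (u : H)

noncomputable instance : AddCommGroup (SliceSpace A θ u) := 
  inferInstanceAs (AddCommGroup (A ⊗[ℂ] C))
noncomputable instance : Module ℂ (SliceSpace A θ u) := inferInstanceAs (Module ℂ (A ⊗[ℂ] C))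

/-- The seminorm `sliceSeminorm θ u` as a group seminorm on `SliceSpace A θ u`. -/
noncomputable def SliceSpace.groupSeminorm : AddGroupSeminorm (SliceSpace A θ u) :=
  (sliceSeminorm (A := A) θ u).toAddGroupSeminorm

noncomputable instance : SeminormedAddCommGroup (SliceSpace A θ u) :=
  (SliceSpace.groupSeminorm θ u).toSeminormedAddCommGroup
noncomputable instance : NormedSpace ℂ (SliceSpace A θ u) where
  norm_smul_le t y := (map_smul_eq_mul (sliceSeminorm (A := A) θ u) t y).le

/-- Left multiplication by `x`, as a bounded operator on `SliceSpace A θ u`. -/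
noncomputable def sliceMul : A ⊗[ℂ] C →ₗ[ℂ] (SliceSpace A θ u →L[ℂ] SliceSpace A θ u) where
  toFun x := LinearMap.mkContinuousOfExistsBound (E := SliceSpace A θ u) (F := SliceSpace A θ u)
    (LinearMap.mulLeft ℂ x) (exists_sliceSeminorm_mul_le θ u x)
  map_add' x y := by
    ext z
    exact add_mul (R := A ⊗[ℂ] C) x y z
  map_smul' t x := by
    ext z
    exact smul_mul_assoc (β := A ⊗[ℂ] C) t x z

/-- The operator seminorm of left multiplication on `SliceSpace A θ u`. -/
noncomputable def sliceOpSeminorm : Seminorm ℂ (A ⊗[ℂ] C) :=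
  (normSeminorm ℂ (SliceSpace A θ u →L[ℂ] SliceSpace A θ u)).comp (sliceMul θ u)

lemma sliceSeminorm_mul_le (x y : A ⊗[ℂ] C) :
    sliceSeminorm θ u (x * y) ≤ sliceOpSeminorm θ u x * sliceSeminorm θ u y :=
  (sliceMul (A := A) θ u x).le_opNorm y

lemma sliceOpSeminorm_le {x : A ⊗[ℂ] C} {M : ℝ} (hM : 0 ≤ M)
    (h : ∀ y, sliceSeminorm θ u (x * y) ≤ M * sliceSeminorm θ u y) :
    sliceOpSeminorm θ u x ≤ M :=
  (sliceMul (A := A) θ u x).opNorm_le_bound hM h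

lemma sliceOpSeminorm_sq_le (x : A ⊗[ℂ] C) :
    sliceOpSeminorm θ u x ^ 2 ≤ sliceOpSeminorm θ u (star x * x) := by
  rw [← Real.le_sqrt (apply_nonneg _ _) (apply_nonneg _ _)]
  refine sliceOpSeminorm_le θ u (Real.sqrt_nonneg _) fun y => ?_
  refine le_of_sq_le_sq ?_ (by positivity)
  rw [mul_pow, Real.sq_sqrt (apply_nonneg _ _), sliceSeminorm_apply, Real.sq_sqrt (norm_nonneg _)]
  have h : sliceInner θ u (x * y) (x * y) = sliceInner θ u y (star x * x * y) := by
    rw [mul_assoc, sliceInner_mul_right (x := star x), star_star]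
  rw [h]
  refine (norm_sliceInner_le θ u _ _).trans ?_
  have := mul_le_mul_of_nonneg_left (sliceSeminorm_mul_le θ u (star x * x) y)
    (apply_nonneg (sliceSeminorm (A := A) θ u) y)
  linarith

lemma isCStarSeminorm_sliceOpSeminorm :
    IsCStarSeminorm (sliceOpSeminorm θ u : Seminorm ℂ (A ⊗[ℂ] C)) := by
  have hmul (x y : A ⊗[ℂ] C) :
      sliceOpSeminorm θ u (x * y) ≤ sliceOpSeminorm θ u x * sliceOpSeminorm θ u y := by
    refine sliceOpSeminorm_le θ u (by positivity) fun z => ?_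
    rw [mul_assoc, mul_assoc]
    exact (sliceSeminorm_mul_le θ u x _).trans
      (mul_le_mul_of_nonneg_left (sliceSeminorm_mul_le θ u y z) (apply_nonneg _ _))
  have hstar (x : A ⊗[ℂ] C) : sliceOpSeminorm θ u x ≤ sliceOpSeminorm θ u (star x) := by
    rcases (apply_nonneg (sliceOpSeminorm (A := A) θ u) x).eq_or_lt with h | h
    · rw [← h]
      exact apply_nonneg _ _
    · nlinarith [sliceOpSeminorm_sq_le θ u x, hmul (star x) x]
  refine ⟨hmul, fun x => le_antisymm ?_ (sliceOpSeminorm_sq_le θ u x), fun a c => ?_⟩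
  · refine (hmul _ _).trans ?_
    rw [sq]
    have := hstar (star x)
    rw [star_star] at this
    gcongr
  · exact sliceOpSeminorm_le θ u (by positivity) (sliceSeminorm_tmul_mul_le θ u a c)

/-- Slicing by the functional `⟨θ(c₁) u, θ(·) θ(c₂) u⟩` is bounded in the C⋆-norm. It is tested
against `(x₁ x₁*) ⊗ c₁` and `x₁* ⊗ c₂`, where `x₁` is the slice itself, so that no approximate
unit of `A` is needed. -/
lemma norm_algSlice_le (c₁ c₂ : C) (x : A ⊗[ℂ] C) :
    ‖algSlice (vectorFunctional θ (θ c₁ u) (θ c₂ u)) x‖ ≤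
      ‖θ c₁ u‖ * ‖θ c₂ u‖ * cstarNorm x := by
  set s := algSlice (vectorFunctional θ (θ c₁ u) (θ c₂ u)) x with hs
  have key (a b : A) : sliceInner θ u (a ⊗ₜ[ℂ] c₁) (x * b ⊗ₜ[ℂ] c₂) = star a * s * b := by
    rw [hs]
    induction x with
    | zero => simp [sliceInner]
    | add x y hx hy => simp only [add_mul, sliceInner_add_right, map_add, mul_add, hx rfl, hy rfl]
    | tmul d e =>
      rw [Algebra.TensorProduct.tmul_mul_tmul, sliceInner_tmul_tmul]
      simp [mul_assoc, mul_smul_comm, smul_mul_assoc]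
  have h1 := norm_sliceInner_le θ u ((s * star s) ⊗ₜ[ℂ] c₁) (x * star s ⊗ₜ[ℂ] c₂)
  have h2 := (sliceSeminorm_mul_le θ u x (star s ⊗ₜ[ℂ] c₂)).trans
    (mul_le_mul_of_nonneg_right (le_cstarNorm (isCStarSeminorm_sliceOpSeminorm θ u) x)
      (apply_nonneg _ _))
  have h3 := h1.trans (mul_le_mul_of_nonneg_left h2 (apply_nonneg _ _))
  have h4 : star (s * star s) * s * star s = star (s * star s) * (s * star s) := by
    rw [mul_assoc]
  rw [key, h4, CStarRing.norm_star_mul_self, sliceSeminorm_tmul, sliceSeminorm_tmul,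
    CStarRing.norm_self_mul_star, norm_star] at h3
  rcases (norm_nonneg s).eq_or_lt with h | h
  · rw [← h]
    exact mul_nonneg (by positivity) (cstarNorm_nonneg x)
  · refine le_of_mul_le_mul_left ?_ (pow_pos h 3)
    linarith

end SliceSpace

/-! ### Finite-rank operators are dense in the compact operators -/

section Compacts

variable {H : Type*} [NormedAddCommGroup H] [InnerProductSpace ℂ H]

lemma isCompactOperator_rankOne (v w : H) :
    IsCompactOperator (InnerProductSpace.rankOne ℂ v w : H →L[ℂ] H) := by
  rw [InnerProductSpace.rankOne_def']
  exact (isCompactOperator_id_iff_finiteDimensional.2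
    (inferInstance : FiniteDimensional ℂ ℂ)).comp_clm _ |>.clm_comp
    (ContinuousLinearMap.toSpanSingleton ℂ v)

lemma exists_finiteDimensional_norm_sub_starProjection_comp_le {T : H →L[ℂ] H}
    (hT : IsCompactOperator T) {ε : ℝ} (hε : 0 < ε) :
    ∃ (U : Submodule ℂ H) (_ : FiniteDimensional ℂ U), ‖T - U.starProjection * T‖ ≤ ε := by
  have hb := (hT.isCompact_closure_image_closedBall (f := (T : H →ₗ[ℂ] H))
    1).totallyBounded.subset subset_closure
  obtain ⟨t, htf, ht⟩ := Metric.totallyBounded_iff.1 hb (ε / 2) (by positivity)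
  have hfin : FiniteDimensional ℂ (Submodule.span ℂ t) := FiniteDimensional.span_of_finite ℂ htf
  refine ⟨Submodule.span ℂ t, hfin, ?_⟩
  refine ContinuousLinearMap.opNorm_le_of_unit_norm hε.le fun x hx => ?_
  obtain ⟨y, hy, hxy⟩ : ∃ y ∈ t, ‖T x - y‖ < ε / 2 := by
    have hm : T x ∈ (T : H →ₗ[ℂ] H) '' Metric.closedBall 0 1 :=
      Set.mem_image_of_mem _ (by simp [hx])
    simpa [dist_eq_norm] using ht hm
  have hPy : (Submodule.span ℂ t).starProjection y = y :=
    Submodule.starProjection_eq_self_iff.2 (Submodule.subset_span hy)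
  have h1 : (T - (Submodule.span ℂ t).starProjection * T) x =
      (T x - y) - (Submodule.span ℂ t).starProjection (T x - y) := by
    rw [map_sub, hPy]
    simp
  rw [h1]
  have h2 := ((Submodule.span ℂ t).starProjection.le_opNorm (T x - y)).trans
    (mul_le_of_le_one_left (norm_nonneg _) (Submodule.starProjection_norm_le _))
  linarith [norm_sub_le (T x - y) ((Submodule.span ℂ t).starProjection (T x - y))]

variable [CompleteSpace H]

/-- The rank-one operator `x ↦ ⟨w, x⟩ v`, as a compact operator. -/
noncomputable def compacts.rankOne (v w : H) : compacts H :=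
  ⟨InnerProductSpace.rankOne ℂ v w, isCompactOperator_rankOne v w⟩

@[simp]
lemma compacts.coe_rankOne (v w : H) :
    (compacts.rankOne v w : H →L[ℂ] H) = InnerProductSpace.rankOne ℂ v w := rfl

lemma compacts.induction_rankOne {P : compacts H → Prop} (k : compacts H)
    (hc : IsClosed {k | P k}) (hz : P 0) (hr : ∀ v w, P (compacts.rankOne v w))
    (ha : ∀ k l, P k → P l → P (k + l)) : P k := by
  refine hc.closure_subset (Metric.mem_closure_iff.2 fun ε hε => ?_)
  obtain ⟨U, hU, h⟩ := exists_finiteDimensional_norm_sub_starProjection_comp_le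
    (T := (k : H →L[ℂ] H)) k.2 (half_pos hε)
  let b := stdOrthonormalBasis ℂ U
  refine ⟨∑ i, compacts.rankOne (b i : H) (star (k : H →L[ℂ] H) (b i)), ?_, ?_⟩
  · exact Finset.sum_induction _ P ha hz fun i _ => hr _ _
  · rw [dist_eq_norm]
    refine lt_of_le_of_lt (le_of_eq_of_le ?_ h) (half_lt_self hε)
    rw [b.starProjection_eq_sum_rankOne, Finset.sum_mul]
    simp only [ContinuousLinearMap.mul_def, InnerProductSpace.rankOne_comp,
      ContinuousLinearMap.star_eq_adjoint]
    change ‖((k - _ : compacts H) : H →L[ℂ] H)‖ = _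
    rw [AddSubgroupClass.coe_sub, AddSubmonoidClass.coe_finsetSum]
    rfl

/-- The representation of `K⁺` on `H` that extends the inclusion of `K`. -/
noncomputable def compactsUnitRep (H : Type*) [NormedAddCommGroup H] [InnerProductSpace ℂ H]
    [CompleteSpace H] : compactsUnit H →⋆ₙₐ[ℂ] (H →L[ℂ] H) :=
  (Unitization.starLift (NonUnitalStarSubalgebraClass.subtype (compacts H)) :
    compactsUnit H →⋆ₐ[ℂ] (H →L[ℂ] H))

@[simp]
lemma compactsUnitRep_inr (k : compacts H) :
    compactsUnitRep H (k : compactsUnit H) = (k : H →L[ℂ] H) := by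
  exact DFunLike.congr_fun (Unitization.starLift.symm_apply_apply
    (NonUnitalStarSubalgebraClass.subtype (compacts H))) k

@[simp]
lemma compactsUnitRep_inl (z : ℂ) :
    compactsUnitRep H (Unitization.inl z : compactsUnit H) = z • (1 : H →L[ℂ] H) := by
  change Unitization.starLift (NonUnitalStarSubalgebraClass.subtype (compacts H))
    (algebraMap ℂ (compactsUnit H) z) = _
  rw [AlgHomClass.commutes, Algebra.algebraMap_eq_smul_one]

@[simp]
lemma compactsUnitRep_one : compactsUnitRep H 1 = 1 := by
  simpa using compactsUnitRep_inl (H := H) 1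

end Compacts

/-! ### Slice maps on the C⋆-tensor product -/

section CompletedSlice

variable {A A' C : Type*} [NonUnitalCStarAlgebra A] [NonUnitalCStarAlgebra A']
  [NonUnitalCStarAlgebra C]

namespace CStarTensor

/-- The elementary tensor as a bounded bilinear map. -/
noncomputable def tmulCLM : A →L[ℂ] C →L[ℂ] CStarTensor A C :=
  LinearMap.mkContinuous₂
    (LinearMap.mk₂ ℂ tmul
      (fun a a' c => (congrArg incl (TensorProduct.add_tmul a a' c)).trans (map_add incl _ _))
      (fun z a c => (congrArg incl (TensorProduct.smul_tmul' z a c)).symm.trans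
        (incl.map_smul z (PreTensor.tmul a c)))
      (fun a c c' => (congrArg incl (TensorProduct.tmul_add a c c')).trans (map_add incl _ _))
      (fun z a c => (congrArg incl (TensorProduct.tmul_smul z a c)).trans
        (incl.map_smul z (PreTensor.tmul a c))))
    1 fun a c => by
      rw [one_mul]
      exact (incl.norm_map _).trans_le (cstarNorm_tmul_le a c)

lemma continuous_tmul_left (c : C) : Continuous fun a : A => tmul a c :=
  (ContinuousLinearMap.flip (tmulCLM (A := A) (C := C)) c).continuous

lemma continuous_tmul_right (a : A) : Continuous fun c : C => tmul a c :=
  (tmulCLM a).continuous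

lemma add_tmul (a a' : A) (c : C) : tmul (a + a') c = tmul a c + tmul a' c :=
  (ContinuousLinearMap.flip (tmulCLM (A := A) (C := C)) c).map_add a a'

lemma tmul_add (a : A) (c c' : C) : tmul a (c + c') = tmul a c + tmul a c' :=
  (tmulCLM a).map_add c c'

lemma tmul_sub (a : A) (c c' : C) : tmul a (c - c') = tmul a c - tmul a c' :=
  (tmulCLM a).map_sub c c'

@[simp]
lemma zero_tmul (c : C) : tmul (0 : A) c = 0 :=
  (ContinuousLinearMap.flip (tmulCLM (A := A) (C := C)) c).map_zero

@[simp]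
lemma tmul_zero (a : A) : tmul a (0 : C) = 0 := (tmulCLM a).map_zero

lemma smul_tmul (z : ℂ) (a : A) (c : C) : tmul (z • a) c = z • tmul a c :=
  (ContinuousLinearMap.flip (tmulCLM (A := A) (C := C)) c).map_smul z a

lemma tmul_smul (z : ℂ) (a : A) (c : C) : tmul a (z • c) = z • tmul a c :=
  (tmulCLM a).map_smul z c

lemma star_tmul (a : A) (c : C) : star (tmul a c) = tmul (star a) (star c) :=
  (incl_star (PreTensor.tmul a c)).symm.trans
    (congrArg incl (TensorProduct.star_tmul a c))

variable {H : Type*} [NormedAddCommGroup H] [InnerProductSpace ℂ H] [CompleteSpace H]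

/-- Slices by arbitrary vectors are bounded, since `K⁺` acts transitively on the nonzero vectors. -/
lemma norm_algSlice_compactsUnit_le (v w : H) (x : PreTensor A (compactsUnit H)) :
    ‖algSlice (A := A) (vectorFunctional (compactsUnitRep H) v w) x‖ ≤ ‖v‖ * ‖w‖ * ‖x‖ := by
  rcases eq_or_ne v 0 with rfl | hv
  · have h : algSlice (A := A) (vectorFunctional (compactsUnitRep H) 0 w) = 0 :=
      TensorProduct.ext' fun a c => by simp
    rw [h]
    exact (norm_zero (E := A)).le.trans (by positivity)
  · -- both vectors are images of `v`: under the identity and under a rank-one operator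
    have h := norm_algSlice_le (A := A) (compactsUnitRep H) v 1
      (((‖v‖ ^ 2 : ℂ)⁻¹ • compacts.rankOne w v : compacts H) : compactsUnit H) x
    have hw : compactsUnitRep H
        (((‖v‖ ^ 2 : ℂ)⁻¹ • compacts.rankOne w v : compacts H) : compactsUnit H) v = w := by
      have : (‖v‖ ^ 2 : ℂ) ≠ 0 := by simpa using hv
      rw [compactsUnitRep_inr]
      change (‖v‖ ^ 2 : ℂ)⁻¹ • InnerProductSpace.rankOne ℂ w v v = w
      rw [InnerProductSpace.rankOne_apply, inner_self_eq_norm_sq_to_K, smul_smul]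
      erw [inv_mul_cancel₀ this]
      rw [one_smul]
    rw [hw, compactsUnitRep_one] at h
    exact h

/-- The slice map `id ⊗ ⟨v, · w⟩` from `A ⊗ K⁺` to `A`. -/
noncomputable def slice (v w : H) : CStarTensor A (compactsUnit H) →L[ℂ] A :=
  LinearMap.extendOfNorm (E := PreTensor A (compactsUnit H))
    (algSlice (A := A) (vectorFunctional (compactsUnitRep H) v w)) incl.toLinearMap

lemma norm_slice_le (v w : H) (x : CStarTensor A (compactsUnit H)) :
    ‖slice v w x‖ ≤ ‖v‖ * ‖w‖ * ‖x‖ :=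
  LinearMap.norm_extendOfNorm_apply_le isDenseInducing_incl.dense _ (fun x => by
    refine (norm_algSlice_compactsUnit_le v w x).trans_eq ?_
    exact congrArg _ (incl.norm_map x).symm) x

@[simp]
lemma slice_tmul (v w : H) (a : A) (c : compactsUnit H) :
    slice v w (tmul a c) = inner ℂ v (compactsUnitRep H c w) • a := by
  refine (LinearMap.extendOfNorm_eq isDenseInducing_incl.dense ⟨‖v‖ * ‖w‖, fun x => ?_⟩
    (PreTensor.tmul a c)).trans (algSlice_tmul _ a c)
  refine (norm_algSlice_compactsUnit_le v w x).trans_eq ?_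
  exact congrArg _ (incl.norm_map x).symm

lemma map_slice (f : A →⋆ₙₐ[ℂ] A') (v w : H) (x : CStarTensor A (compactsUnit H)) :
    f (slice v w x) = slice v w (map f (NonUnitalStarAlgHom.id ℂ (compactsUnit H)) x) := by
  induction x using induction_tmul with
  | hc => exact isClosed_eq ((map_continuous f).comp (slice v w).continuous)
            ((slice v w).continuous.comp (continuous_map _ _))
  | hz => simp
  | ht a c => simp
  | ha x y hx hy => simp only [map_add, hx, hy]

lemma slice_mul_tmul (v w : H) (x : CStarTensor A (compactsUnit H)) (a : A)
    (c : compactsUnit H) :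
    slice v w (x * tmul a c) = slice v (compactsUnitRep H c w) x * a := by
  induction x using induction_tmul with
  | hc => exact isClosed_eq ((slice v w).continuous.comp (by fun_prop))
            (((slice v _).continuous).mul continuous_const)
  | hz => simp
  | ht b d => simp [tmul_mul_tmul, smul_mul_assoc]
  | ha x y hx hy => simp only [map_add, add_mul, hx, hy]

end CStarTensor
end CompletedSlice

/-! ### Elements whose slices vanish -/

section Vanishing

variable {A A' H : Type*} [NonUnitalCStarAlgebra A] [NonUnitalCStarAlgebra A']
  [NormedAddCommGroup H] [InnerProductSpace ℂ H] [CompleteSpace H]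

lemma compacts.rankOne_mul_mul_rankOne (k : compacts H) (v v' w w' : H) :
    compacts.rankOne v v' * k * compacts.rankOne w w' =
      (inner ℂ v' ((k : H →L[ℂ] H) w) : ℂ) • compacts.rankOne v w' := by
  refine Subtype.ext (ContinuousLinearMap.ext fun x => ?_)
  change InnerProductSpace.rankOne ℂ v v' ((k : H →L[ℂ] H) (InnerProductSpace.rankOne ℂ w w' x)) =
    (inner ℂ v' ((k : H →L[ℂ] H) w) : ℂ) • InnerProductSpace.rankOne ℂ v w' x
  simp only [InnerProductSpace.rankOne_apply, map_smul, smul_smul]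
  rw [mul_comm]

lemma isClosed_range_of_injective (f : A →⋆ₙₐ[ℂ] A') (hf : Function.Injective f) :
    IsClosed (Set.range f) :=
  (NonUnitalStarAlgHom.isometry f hf).isClosedEmbedding.isClosed_range

namespace CStarTensor

/-- The map `id ⊗ ι` from `A ⊗ K` to `A ⊗ K⁺`. -/
noncomputable abbrev unitInclusion (A H : Type*) [NonUnitalCStarAlgebra A] [NormedAddCommGroup H]
    [InnerProductSpace ℂ H] [CompleteSpace H] :
    CStarTensor A (compacts H) →⋆ₙₐ[ℂ] CStarTensor A (compactsUnit H) :=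
  map (NonUnitalStarAlgHom.id ℂ A) (Unitization.inrNonUnitalStarAlgHom ℂ (compacts H))

lemma unitInclusion_tmul (a : A) (k : compacts H) :
    unitInclusion A H (tmul a k) = tmul a (k : compactsUnit H) := by
  simp

lemma induction_rankOne {P : CStarTensor A (compacts H) → Prop} (x : CStarTensor A (compacts H))
    (hc : IsClosed {x | P x}) (hz : P 0) (hr : ∀ a v w, P (tmul a (compacts.rankOne v w)))
    (ha : ∀ x y, P x → P y → P (x + y)) : P x := by
  induction x using induction_tmul with
  | hc => exact hc
  | hz => exact hz
  | ht a k =>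
    induction k using compacts.induction_rankOne with
    | hc => exact hc.preimage (continuous_tmul_right a)
    | hz => simpa using hz
    | hr v w => exact hr a v w
    | ha k l hk hl => simpa only [tmul_add] using ha _ _ hk hl
  | ha x y hx hy => exact ha x y hx hy

lemma tmul_rankOne_mul_mul (a a' : A) (v v' w w' : H) (x : CStarTensor A (compacts H)) :
    tmul a (compacts.rankOne v v') * x * tmul a' (compacts.rankOne w w') =
      tmul (a * slice v' w (unitInclusion A H x) * a') (compacts.rankOne v w') := by
  induction x using induction_tmul with
  | hc =>
    refine isClosed_eq (by fun_prop) ((continuous_tmul_left _).comp ?_)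
    exact (continuous_const.mul ((slice v' w).continuous.comp (continuous_map _ _))).mul
      continuous_const
  | hz => simp
  | ht b k =>
    rw [tmul_mul_tmul, tmul_mul_tmul, compacts.rankOne_mul_mul_rankOne, tmul_smul]
    simp [mul_smul_comm, smul_mul_assoc, smul_tmul]
  | ha x y hx hy => simp only [map_add, mul_add, add_mul, hx, hy, add_tmul]

/-- The slices of `x ∈ A ⊗ K` determine `z * x * z'` for elementary tensors of finite rank, hence
`x* x x*`, hence `x`. -/
lemma eq_zero_of_slice_unitInclusion_eq_zero {x : CStarTensor A (compacts H)}
    (h : ∀ v w : H, slice v w (unitInclusion A H x) = 0) : x = 0 := by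
  have h1 (z z' : CStarTensor A (compacts H)) : z * x * z' = 0 := by
    induction z using induction_rankOne with
    | hc => exact isClosed_eq ((continuous_id.mul continuous_const).mul continuous_const)
              continuous_const
    | hz => rw [zero_mul, zero_mul]
    | ha y y' hy hy' => rw [add_mul, add_mul, hy, hy', add_zero]
    | hr a v v' =>
      induction z' using induction_rankOne with
      | hc => exact isClosed_eq (continuous_const.mul continuous_id) continuous_const
      | hz => rw [mul_zero]
      | ha y y' hy hy' => rw [mul_add, hy, hy', add_zero]
      | hr a' w w' => rw [tmul_rankOne_mul_mul, h, mul_zero, zero_mul, zero_tmul]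
  have h2 : star (star x * x) * (star x * x) = 0 := by
    rw [star_mul, star_star, ← mul_assoc, h1, zero_mul]
  rwa [CStarRing.star_mul_self_eq_zero_iff, CStarRing.star_mul_self_eq_zero_iff] at h2

lemma injective_unitInclusion : Function.Injective (unitInclusion A H) :=
  (injective_iff_map_eq_zero _).2 fun x hx =>
    eq_zero_of_slice_unitInclusion_eq_zero fun v w => by rw [hx, map_zero]

/-- The scalar part `λ + k ↦ λ` as a ⋆-endomorphism of `K⁺`. -/
noncomputable def scalarPart (H : Type*) [NormedAddCommGroup H] [InnerProductSpace ℂ H]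
    [CompleteSpace H] : compactsUnit H →⋆ₙₐ[ℂ] compactsUnit H :=
  ((StarAlgHom.ofId ℂ (compactsUnit H)).comp
    { Unitization.fstHom ℂ (compacts H) with map_star' := Unitization.fst_star } :
    compactsUnit H →⋆ₐ[ℂ] compactsUnit H)

lemma scalarPart_apply (c : compactsUnit H) : scalarPart H c = Unitization.inl c.fst :=
  rfl

lemma scalarPart_eq_smul_one (c : compactsUnit H) : scalarPart H c = c.fst • 1 := by
  rw [scalarPart_apply, ← Algebra.algebraMap_eq_smul_one]
  rfl

lemma sub_map_scalarPart_mem_range (x : CStarTensor A (compactsUnit H)) :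
    x - map (NonUnitalStarAlgHom.id ℂ A) (scalarPart H) x ∈ Set.range (unitInclusion A H) := by
  have hcl := isClosed_range_of_injective _ (injective_unitInclusion (A := A) (H := H))
  induction x using induction_tmul with
  | hc => exact hcl.preimage (continuous_id.sub (continuous_map _ _))
  | hz => exact ⟨0, by simp⟩
  | ht a c =>
    refine ⟨tmul a c.snd, ?_⟩
    rw [unitInclusion_tmul, map_tmul, NonUnitalStarAlgHom.coe_id, id, ← tmul_sub, scalarPart_apply]
    congr 1
    rw [eq_sub_iff_add_eq', Unitization.inl_fst_add_inr_snd_eq]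
  | ha x y hx hy =>
    obtain ⟨x', hx'⟩ := hx
    obtain ⟨y', hy'⟩ := hy
    refine ⟨x' + y', ?_⟩
    rw [map_add, hx', hy', map_add]
    abel

lemma map_scalarPart_eq_tmul_one {u : H} (hu : ‖u‖ = 1) (x : CStarTensor A (compactsUnit H)) :
    map (NonUnitalStarAlgHom.id ℂ A) (scalarPart H) x =
      tmul (slice u u (map (NonUnitalStarAlgHom.id ℂ A) (scalarPart H) x)) 1 := by
  induction x using induction_tmul with
  | hc => exact isClosed_eq (continuous_map _ _) ((continuous_tmul_left _).comp
            ((slice u u).continuous.comp (continuous_map _ _)))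
  | hz => simp
  | ht a c =>
    simp [scalarPart_eq_smul_one, tmul_smul, smul_tmul, inner_self_eq_norm_sq_to_K, hu]
  | ha x y hx hy => rw [map_add, map_add, add_tmul, ← hx, ← hy]

/-- Compact operators vanish along an orthonormal sequence. -/
lemma tendsto_slice_unitInclusion {e : ℕ → H} (he : Orthonormal ℂ e)
    (x : CStarTensor A (compacts H)) :
    Filter.Tendsto (fun n => slice (e n) (e n) (unitInclusion A H x)) Filter.atTop (nhds 0) := by
  have hle (n : ℕ) (y : CStarTensor A (compacts H)) :
      ‖slice (e n) (e n) (unitInclusion A H y)‖ ≤ ‖y‖ := by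
    refine (norm_slice_le _ _ _).trans ?_
    rw [he.1 n, one_mul, one_mul]
    exact NonUnitalStarAlgHom.norm_apply_le _ y
  induction x using induction_rankOne with
  | hc =>
    refine isClosed_of_closure_subset fun y hy => Metric.tendsto_atTop.2 fun ε hε => ?_
    obtain ⟨z, hz, hyz⟩ := Metric.mem_closure_iff.1 hy (ε / 2) (half_pos hε)
    obtain ⟨N, hN⟩ := Metric.tendsto_atTop.1 hz (ε / 2) (half_pos hε)
    refine ⟨N, fun n hn => ?_⟩
    have h1 := hN n hn
    have h2 := hle n (y - z)
    rw [map_sub, map_sub] at h2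
    rw [dist_zero_right] at h1 ⊢
    rw [dist_eq_norm] at hyz
    linarith [norm_sub_norm_le (slice (e n) (e n) (unitInclusion A H y))
      (slice (e n) (e n) (unitInclusion A H z))]
  | hz => simp
  | ha x y hx hy => simpa only [map_add, add_zero] using hx.add hy
  | hr a v w =>
    have hs (z : H) : Filter.Tendsto (fun n => (inner ℂ (e n) z : ℂ)) Filter.atTop (nhds 0) := by
      have h := (he.inner_products_summable z).tendsto_atTop_zero
      refine squeeze_zero_norm (a := fun n => √(‖(inner ℂ (e n) z : ℂ)‖ ^ 2)) (fun n => ?_) ?_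
      · rw [Real.sqrt_sq (norm_nonneg _)]
      · have h2 := (Real.continuous_sqrt.tendsto 0).comp h
        rwa [Real.sqrt_zero] at h2
    have h1 : Filter.Tendsto (fun n => ((star (inner ℂ (e n) w : ℂ) * inner ℂ (e n) v : ℂ)) • a)
        Filter.atTop (nhds 0) := by
      simpa using (((continuous_star.tendsto (0 : ℂ)).comp (hs w)).mul (hs v)).smul_const a
    refine h1.congr fun n => ?_
    rw [unitInclusion_tmul, slice_tmul, compactsUnitRep_inr, compacts.coe_rankOne,
      InnerProductSpace.rankOne_apply, inner_smul_right]
    congr 2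
    exact inner_conj_symm _ _

lemma exists_orthonormal_nat (hH : ¬ FiniteDimensional ℂ H) : ∃ e : ℕ → H, Orthonormal ℂ e := by
  obtain ⟨w, b, hb⟩ := exists_hilbertBasis ℂ H
  have hw : Infinite w := by
    rw [← not_finite_iff_infinite]
    intro hfin
    have := Fintype.ofFinite w
    exact hH b.toOrthonormalBasis.toBasis.finiteDimensional_of_finite
  exact ⟨fun n => b (Infinite.natEmbedding w n),
    b.orthonormal.comp _ (Infinite.natEmbedding w).injective⟩

/-- An element of `A ⊗ K⁺` is the sum of an element of `A ⊗ K` and some `a ⊗ 1`. Along an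
orthonormal sequence the slices of the former tend to `0` and those of the latter are `a`. -/
lemma eq_zero_of_slice_eq_zero (hH : ¬ FiniteDimensional ℂ H)
    {x : CStarTensor A (compactsUnit H)} (h : ∀ v w : H, slice v w x = 0) : x = 0 := by
  obtain ⟨e, he⟩ := exists_orthonormal_nat hH
  obtain ⟨y, hy⟩ := sub_map_scalarPart_mem_range x
  set z := map (NonUnitalStarAlgHom.id ℂ A) (scalarPart H) x with hz
  have hz1 := map_scalarPart_eq_tmul_one (he.1 0) x
  rw [← hz] at hz1
  set a := slice (e 0) (e 0) z with ha
  have hslice (n : ℕ) : slice (e n) (e n) (unitInclusion A H y) = -a := by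
    rw [hy, map_sub, h, zero_sub, hz1, slice_tmul, compactsUnitRep_one]
    simp [inner_self_eq_norm_sq_to_K, he.1 n]
  have ha0 : -a = 0 := tendsto_nhds_unique (tendsto_const_nhds.congr fun n => (hslice n).symm)
    (tendsto_slice_unitInclusion he y)
  have hz0 : z = 0 := by rw [hz1, neg_eq_zero.1 ha0, zero_tmul]
  rw [hz0, sub_zero] at hy
  rw [← hy, eq_zero_of_slice_unitInclusion_eq_zero (x := y) (by simpa [hy] using h), map_zero]

lemma injective_map_id_compactsUnit (hH : ¬ FiniteDimensional ℂ H) {f : A →⋆ₙₐ[ℂ] A'}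
    (hf : Function.Injective f) :
    Function.Injective (map f (NonUnitalStarAlgHom.id ℂ (compactsUnit H))) :=
  (injective_iff_map_eq_zero _).2 fun x hx => eq_zero_of_slice_eq_zero hH fun v w =>
    hf (by rw [map_slice, hx, map_zero, map_zero])

lemma injective_map_inr (hH : ¬ FiniteDimensional ℂ H) {f : A →⋆ₙₐ[ℂ] A'}
    (hf : Function.Injective f) :
    Function.Injective (map f (Unitization.inrNonUnitalStarAlgHom ℂ (compacts H))) := by
  have h : ⇑(map f (Unitization.inrNonUnitalStarAlgHom ℂ (compacts H))) =
      map f (NonUnitalStarAlgHom.id ℂ (compactsUnit H)) ∘ unitInclusion A H := by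
    funext x
    rw [Function.comp_apply, map_comp_apply]
    rfl
  rw [h]
  exact (injective_map_id_compactsUnit hH hf).comp injective_unitInclusion

end CStarTensor
end Vanishing

/-! ### Invertibility of operators that stay bounded below -/

section Continuity

variable {E : Type*} [NormedAddCommGroup E] [NormedSpace ℂ E] [CompleteSpace E]

lemma isUnit_of_norm_sub_lt_of_antilipschitz {S T : E →L[ℂ] E} {K : ℝ} (hS : IsUnit S)
    (hK : ∀ x, ‖x‖ ≤ K * ‖S x‖) (hK0 : 0 < K) (hT : ‖T - S‖ < K⁻¹) : IsUnit T := by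
  cases subsingleton_or_nontrivial (E →L[ℂ] E)
  · exact isUnit_of_subsingleton T
  · obtain ⟨U, rfl⟩ := hS
    have hU : ‖(↑U⁻¹ : E →L[ℂ] E)‖ ≤ K := by
      refine ContinuousLinearMap.opNorm_le_bound _ hK0.le fun y => ?_
      have h : (U : E →L[ℂ] E) ((↑U⁻¹ : E →L[ℂ] E) y) = y :=
        DFunLike.congr_fun (Units.mul_inv U) y
      simpa only [h] using hK ((↑U⁻¹ : E →L[ℂ] E) y)
    exact (U.ofNearby T (hT.trans_le (inv_anti₀ (Units.norm_pos U⁻¹) hU))).isUnit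

/-- The method of continuity: `S + t` is invertible for large `t`, and invertibility persists on
steps of a fixed length down to `t = 0`. -/
lemma isUnit_of_forall_norm_le_add_smul {S : E →L[ℂ] E} {K : ℝ} (hK0 : 0 < K)
    (hK : ∀ t : ℝ, 0 ≤ t → ∀ x, ‖x‖ ≤ K * ‖S x + (t : ℂ) • x‖) : IsUnit S := by
  have step (N : ℕ) : IsUnit (S + ((N * (2 * K)⁻¹ : ℝ) : ℂ) • (1 : E →L[ℂ] E)) → IsUnit S := by
    induction N with
    | zero => simp
    | succ N ih =>
      intro h
      refine ih (isUnit_of_norm_sub_lt_of_antilipschitz h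
        (hK (((N + 1 : ℕ) : ℝ) * (2 * K)⁻¹) (by positivity)) hK0 ?_)
      rw [add_sub_add_left_eq_sub, ← sub_smul, ← Complex.ofReal_sub]
      have h1 : ((N : ℝ) * (2 * K)⁻¹ - ((N + 1 : ℕ) : ℝ) * (2 * K)⁻¹) = -(2 * K)⁻¹ := by
        push_cast
        ring
      rw [h1]
      refine (norm_smul_le _ _).trans_lt ?_
      refine (mul_le_of_le_one_right (norm_nonneg _) ContinuousLinearMap.norm_id_le).trans_lt ?_
      rw [Complex.norm_real, norm_neg, Real.norm_of_nonneg (by positivity)]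
      exact inv_strictAnti₀ hK0 (by linarith)
  obtain ⟨N, hN⟩ := exists_nat_gt (‖S‖ * (2 * K))
  refine step N ?_
  cases subsingleton_or_nontrivial E
  · exact isUnit_of_subsingleton _
  · have h : ((N * (2 * K)⁻¹ : ℝ) : ℂ) ∈ resolventSet ℂ (-S) := by
      refine spectrum.mem_resolventSet_of_norm_lt ?_
      rw [norm_neg, Complex.norm_real, Real.norm_of_nonneg (by positivity), ← div_eq_mul_inv]
      exact (lt_div_iff₀ (by positivity)).2 hN
    rw [spectrum.mem_resolventSet_iff, sub_neg_eq_add, Algebra.algebraMap_eq_smul_one] at h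
    rwa [add_comm]

end Continuity

/-! ### The inner product of a covering -/

section CovInner

variable {B' G : Type*} [NonUnitalCStarAlgebra B'] [Group G] [Fintype G]
  (β : G →* (B' ≃⋆ₐ[ℂ] B'))

lemma covInner_add_right (a b c : B') :
    covInner β a (b + c) = covInner β a b + covInner β a c := by
  simp [covInner, mul_add, Finset.sum_add_distrib]

lemma covInner_smul_right (z : ℂ) (a b : B') : covInner β a (z • b) = z • covInner β a b := by
  simp [covInner, mul_smul_comm, Finset.smul_sum]

lemma covInner_sum_right {ι : Type*} (s : Finset ι) (a : B') (b : ι → B') :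
    covInner β a (∑ k ∈ s, b k) = ∑ k ∈ s, covInner β a (b k) := by
  simp only [covInner, Finset.mul_sum, map_sum]
  exact Finset.sum_comm

lemma star_covInner (a b : B') : star (covInner β a b) = covInner β b a := by
  simp [covInner, ← map_star]

lemma covInner_add_left (a b c : B') :
    covInner β (a + b) c = covInner β a c + covInner β b c := by
  rw [← star_covInner, covInner_add_right, star_add, star_covInner, star_covInner]

lemma covInner_mul_of_fixed (a b : B') {c : B'} (hc : ∀ g, β g c = c) :
    covInner β a (b * c) = covInner β a b * c := by
  simp [covInner, Finset.sum_mul, ← mul_assoc, hc]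

lemma map_covInner (g : G) (a b : B') : β g (covInner β a b) = covInner β a b := by
  simp only [covInner, map_sum]
  refine Fintype.sum_equiv (Equiv.mulLeft g) _ _ fun h => ?_
  simp

lemma norm_covInner_le (a b : B') : ‖covInner β a b‖ ≤ Fintype.card G * ‖a‖ * ‖b‖ := by
  refine (norm_sum_le_of_le (f := fun g => β g (star a * b)) _
    (n := fun _ => ‖a‖ * ‖b‖) fun g _ => ?_).trans_eq ?_
  · refine (NonUnitalStarAlgHom.norm_apply_le (β g) _).trans ?_
    simpa using norm_mul_le (star a) b
  · simp [mul_assoc]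

lemma star_mul_self_le_covInner [PartialOrder B'] [StarOrderedRing B'] (a : B') :
    star a * a ≤ covInner β a a := by
  have h := Finset.single_le_sum (f := fun g => β g (star a * a)) (s := Finset.univ)
    (fun g _ => by
      rw [map_mul, map_star]
      exact star_mul_self_nonneg _) (Finset.mem_univ 1)
  simpa [covInner] using h

lemma norm_sq_le_norm_covInner (a : B') : ‖a‖ ^ 2 ≤ ‖covInner β a a‖ := by
  let _ := CStarAlgebra.spectralOrder B'
  have _ := CStarAlgebra.spectralOrderedRing B'
  rw [sq, ← CStarRing.norm_star_mul_self]
  exact CStarAlgebra.norm_le_norm_of_nonneg_of_le (star_mul_self_nonneg a)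
    (star_mul_self_le_covInner β a)

/-- `covInner β a` as a bounded operator. -/
noncomputable def covInnerCLM (a : B') : B' →L[ℂ] B' :=
  LinearMap.mkContinuous
    { toFun := covInner β a
      map_add' := covInner_add_right β a
      map_smul' := fun z b => covInner_smul_right β z a b }
    (Fintype.card G * ‖a‖) (norm_covInner_le β a)

@[simp]
lemma covInnerCLM_apply (a b : B') : covInnerCLM β a b = covInner β a b := rfl

lemma continuous_covInner_left (b : B') :
    Continuous fun a => covInner β a b :=
  continuous_finsetSum _ fun g _ =>
    (map_continuous (β g : B' →⋆ₙₐ[ℂ] B')).comp (by fun_prop)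

lemma continuous_covInner_right (a : B') : Continuous (covInner β a) :=
  (covInnerCLM β a).continuous

/-- The frame operator `x ↦ ∑ k, e k ⟨e k, x⟩`. -/
noncomputable def frameOperator {n : ℕ} (e : Fin n → B') : B' →L[ℂ] B' :=
  ∑ k, ContinuousLinearMap.mul ℂ B' (e k) ∘L covInnerCLM β (e k)

lemma frameOperator_apply {n : ℕ} (e : Fin n → B') (x : B') :
    frameOperator β e x = ∑ k, e k * covInner β (e k) x := by
  simp [frameOperator]

lemma covInner_frameOperator {n : ℕ} (e : Fin n → B') (x y : B') :
    covInner β x (frameOperator β e y) = ∑ k, covInner β x (e k) * covInner β (e k) y := by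
  rw [frameOperator_apply, covInner_sum_right]
  exact Finset.sum_congr rfl fun k _ =>
    covInner_mul_of_fixed β _ _ fun g => map_covInner β g _ _

lemma covInner_frameOperator_left {n : ℕ} (e : Fin n → B') (x y : B') :
    covInner β (frameOperator β e x) y = covInner β x (frameOperator β e y) := by
  rw [← star_covInner, covInner_frameOperator, covInner_frameOperator, star_sum]
  exact Finset.sum_congr rfl fun k _ => by rw [star_mul, star_covInner, star_covInner]

/-- If the `e k` generate `B'` with coefficients whose norm is controlled, the frame operator is
bounded below; so are its translates by nonnegative scalars. -/
lemma norm_le_frameOperator_add_smul {n : ℕ} {e : Fin n → B'} {M : ℝ}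
    (hgen : ∀ x, ∃ b : Fin n → B', (∀ k g, β g (b k) = b k) ∧ (∀ k, ‖b k‖ ≤ M * ‖x‖) ∧
      ∑ k, e k * b k = x) (t : ℝ) (ht : 0 ≤ t) (x : B') :
    ‖x‖ ≤ ((M * n) ^ 2 * Fintype.card G) * ‖frameOperator β e x + (t : ℂ) • x‖ := by
  let _ := CStarAlgebra.spectralOrder B'
  have _ := CStarAlgebra.spectralOrderedRing B'
  rcases eq_or_ne x 0 with rfl | hx
  · simp
  set D := ‖covInner β x (frameOperator β e x + (t : ℂ) • x)‖ with hD
  have hD2 : D ≤ Fintype.card G * ‖x‖ * ‖frameOperator β e x + (t : ℂ) • x‖ :=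
    norm_covInner_le β _ _
  have hq (k : Fin n) : ‖covInner β x (e k)‖ ≤ √D := by
    refine Real.le_sqrt_of_sq_le ?_
    rw [sq, ← CStarRing.norm_self_mul_star, star_covInner, hD, covInner_add_right,
      covInner_frameOperator, covInner_smul_right]
    have hpos (l : Fin n) : 0 ≤ covInner β x (e l) * covInner β (e l) x := by
      rw [← star_covInner β x]
      exact mul_star_self_nonneg _
    refine CStarAlgebra.norm_le_norm_of_nonneg_of_le (hpos k) ?_
    refine (Finset.single_le_sum (f := fun l => covInner β x (e l) * covInner β (e l) x)
      (fun l _ => hpos l) (Finset.mem_univ k)).trans (le_add_of_nonneg_right ?_)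
    rw [Complex.coe_smul]
    exact smul_nonneg ht ((star_mul_self_nonneg x).trans (star_mul_self_le_covInner β x))
  have hx1 : ‖x‖ ^ 2 ≤ n * √D * (M * ‖x‖) := by
    obtain ⟨b, hb, hbM, hbx⟩ := hgen x
    refine (norm_sq_le_norm_covInner β x).trans ?_
    nth_rw 2 [← hbx]
    rw [covInner_sum_right]
    refine (norm_sum_le_of_le (n := fun _ => √D * (M * ‖x‖)) _ fun k _ => ?_).trans_eq ?_
    · rw [covInner_mul_of_fixed β _ _ (hb k)]
      exact (norm_mul_le _ _).trans (mul_le_mul (hq k) (hbM k) (norm_nonneg _)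
        (Real.sqrt_nonneg _))
    · simp [mul_assoc]
  have hx0 : 0 < ‖x‖ := norm_pos_iff.2 hx
  have hx2 : ‖x‖ ≤ M * n * √D := by
    refine le_of_mul_le_mul_right ?_ hx0
    nlinarith
  have hx3 : ‖x‖ ^ 2 ≤ (M * n) ^ 2 * D := by
    have := pow_le_pow_left₀ hx0.le hx2 2
    rwa [mul_pow _ (√D), Real.sq_sqrt (norm_nonneg _)] at this
  refine le_of_mul_le_mul_right ?_ hx0
  have := mul_le_mul_of_nonneg_left hD2 (sq_nonneg (M * n))
  nlinarith

end CovInner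

/-! ### Finite frames of unital coverings -/

section Frame

variable {B B' G : Type*} [CStarAlgebra B] [CStarAlgebra B'] [Group G] [Fintype G]
  {ρ : B →⋆ₐ[ℂ] B'} {β : G →* (B' ≃⋆ₐ[ℂ] B')}

/-- `B'` has a finite frame over its fixed-point algebra: with `S` the frame operator of a finite
set of generators `e`, the dual frame is `S⁻¹ e`. -/
lemma IsUnitalFiniteFoldCovering.exists_frame (h : IsUnitalFiniteFoldCovering ρ β) :
    ∃ (n : ℕ) (e f : Fin n → B'), ∀ x, ∑ k, e k * covInner β (f k) x = x := by
  have hfix (b : B) (g : G) : β g (ρ b) = ρ b := by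
    have : ρ b ∈ {b : B' | ∀ g : G, β g b = b} := h.range_eq ▸ Set.mem_range_self b
    exact this g
  obtain ⟨n, e, he⟩ : ∃ (n : ℕ) (e : Fin n → B'), ∀ x, ∃ b : Fin n → B, ∑ k, e k * ρ (b k) = x := by
    let _ := rightModule ρ
    have := h.finite
    obtain ⟨n, e, he⟩ := Module.Finite.exists_fin (R := Bᵐᵒᵖ) (M := B')
    refine ⟨n, e, fun x => ?_⟩
    obtain ⟨c, hc⟩ := (Submodule.mem_span_range_iff_exists_fun Bᵐᵒᵖ).1
      (he ▸ Submodule.mem_top : x ∈ Submodule.span Bᵐᵒᵖ (Set.range e))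
    exact ⟨fun k => (c k).unop, hc⟩
  -- the coefficients can be bounded by the open mapping theorem
  let ρL : B →L[ℂ] B' := ⟨(ρ : B →ₗ[ℂ] B'), map_continuous ρ⟩
  let T : (Fin n → B) →L[ℂ] B' :=
    ∑ k, ContinuousLinearMap.mul ℂ B' (e k) ∘L ρL ∘L ContinuousLinearMap.proj k
  have hT (b : Fin n → B) : T b = ∑ k, e k * ρ (b k) := by
    simp only [T, sum_apply]
    rfl
  obtain ⟨M, -, hbound⟩ := T.exists_preimage_norm_le fun x => by
    obtain ⟨b, hb⟩ := he x
    exact ⟨b, (hT b).trans hb⟩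
  have hbelow := norm_le_frameOperator_add_smul β (e := e) fun x => by
    obtain ⟨b, hb, hbx⟩ := hbound x
    refine ⟨fun k => ρ (b k), fun k g => hfix _ g, fun k => ?_, (hT b).symm.trans hb⟩
    exact (NonUnitalStarAlgHom.norm_apply_le ρ (b k)).trans ((norm_le_pi_norm b k).trans hbx)
  obtain ⟨U, hU⟩ : IsUnit (frameOperator β e) :=
    isUnit_of_forall_norm_le_add_smul (K := (M * n) ^ 2 * Fintype.card G + 1) (by positivity)
      fun t ht x => (hbelow t ht x).trans
        (mul_le_mul_of_nonneg_right (le_add_of_nonneg_right zero_le_one) (norm_nonneg _))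
  have hinv (x : B') : frameOperator β e ((↑U⁻¹ : B' →L[ℂ] B') x) = x := by
    rw [← hU]
    exact DFunLike.congr_fun (Units.mul_inv U) x
  refine ⟨n, e, fun k => (↑U⁻¹ : B' →L[ℂ] B') (e k), fun x => ?_⟩
  conv_rhs => rw [← hinv x, frameOperator_apply]
  refine Finset.sum_congr rfl fun k _ => ?_
  have hk : covInner β (e k) ((↑U⁻¹ : B' →L[ℂ] B') x) =
      covInner β (frameOperator β e ((↑U⁻¹ : B' →L[ℂ] B') (e k))) ((↑U⁻¹ : B' →L[ℂ] B') x) := by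
    rw [hinv]
  rw [hk, covInner_frameOperator_left, hinv]

/-- A finite frame over the fixed-point algebra splits `B'` off a finite free module. -/
lemma finite_and_projective_of_frame (hρ : Function.Injective ρ)
    (hrange : Set.range ρ = {b : B' | ∀ g : G, β g b = b}) {n : ℕ} {e f : Fin n → B'}
    (hframe : ∀ x, ∑ k, e k * covInner β (f k) x = x) :
    letI := rightModule ρ
    Module.Finite Bᵐᵒᵖ B' ∧ Module.Projective Bᵐᵒᵖ B' := by
  let _ := rightModule ρ
  have hmem (k : Fin n) (x : B') : ∃ b, ρ b = covInner β (f k) x := by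
    have : covInner β (f k) x ∈ Set.range ρ := by
      rw [hrange]
      exact fun g => map_covInner β g _ _
    exact this
  choose r hr using hmem
  have hsmul (b : Bᵐᵒᵖ) (x : B') : b • x = x * ρ b.unop := rfl
  let s : B' →ₗ[Bᵐᵒᵖ] (Fin n → Bᵐᵒᵖ) :=
    { toFun := fun x k => MulOpposite.op (r k x)
      map_add' := fun x y => by
        funext k
        refine MulOpposite.unop_injective (hρ ?_)
        simp only [Pi.add_apply, MulOpposite.unop_add, MulOpposite.unop_op, map_add, hr,
          covInner_add_right]
      map_smul' := fun b x => by
        funext k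
        refine MulOpposite.unop_injective (hρ ?_)
        have hb : ∀ g, β g (ρ b.unop) = ρ b.unop := by
          have : ρ b.unop ∈ {b : B' | ∀ g : G, β g b = b} := hrange ▸ Set.mem_range_self _
          exact this
        simp only [hsmul, Pi.smul_apply, RingHom.id_apply, smul_eq_mul, MulOpposite.unop_mul,
          MulOpposite.unop_op, map_mul, hr, covInner_mul_of_fixed β _ _ hb] }
  let L : (Fin n → Bᵐᵒᵖ) →ₗ[Bᵐᵒᵖ] B' := Fintype.linearCombination Bᵐᵒᵖ e
  have hLs : L ∘ₗ s = LinearMap.id := by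
    ext x
    simp only [L, s, LinearMap.comp_apply, Fintype.linearCombination_apply, LinearMap.coe_mk,
      AddHom.coe_mk, hsmul, MulOpposite.unop_op, hr, hframe, LinearMap.id_apply]
  exact ⟨Module.Finite.of_surjective L fun x => ⟨s x, DFunLike.congr_fun hLs x⟩,
    Module.Projective.of_split s L hLs⟩

end Frame

/-! ### Stabilised coverings -/

section Stabilisation

namespace CStarTensor

variable {A A' B B' C G H : Type*} [NonUnitalCStarAlgebra A] [NonUnitalCStarAlgebra A']
  [CStarAlgebra B] [CStarAlgebra B'] [NonUnitalCStarAlgebra C] [Group G] [Fintype G]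
  [NormedAddCommGroup H] [InnerProductSpace ℂ H] [CompleteSpace H]

lemma stabUnital_apply (ρ : B →⋆ₐ[ℂ] B') (x : CStarTensor B (compactsUnit H)) :
    stabUnital H ρ x =
      map (ρ : B →⋆ₙₐ[ℂ] B') (NonUnitalStarAlgHom.id ℂ (compactsUnit H)) x := rfl

lemma sum_tmul {ι : Type*} (s : Finset ι) (a : ι → A) (c : C) :
    tmul (∑ k ∈ s, a k) c = ∑ k ∈ s, tmul (a k) c :=
  map_sum (ContinuousLinearMap.flip (tmulCLM (A := A) (C := C)) c) a s

lemma covInner_mapAction_tmul (β : G →* (A ≃⋆ₐ[ℂ] A)) (a b : A) (c d : C) :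
    covInner (mapAction β C) (tmul a c) (tmul b d) = tmul (covInner β a b) (star c * d) := by
  simp only [covInner, star_tmul, tmul_mul_tmul, mapAction_tmul, sum_tmul]

/-- A continuous additive map that sends elementary tensors to the range of an injective
⋆-homomorphism takes all its values there, since that range is closed. -/
lemma mem_range_of_forall_tmul {D : Type*} [NonUnitalCStarAlgebra D] {f : D →⋆ₙₐ[ℂ] A'}
    (hf : Function.Injective f) {φ : CStarTensor A C → A'} (hφ : Continuous φ)
    (hadd : ∀ x y, φ (x + y) = φ x + φ y) (ht : ∀ a c, φ (tmul a c) ∈ Set.range f)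
    (x : CStarTensor A C) : φ x ∈ Set.range f := by
  induction x using induction_tmul with
  | hc => exact (isClosed_range_of_injective f hf).preimage hφ
  | hz => exact ⟨0, (map_zero f).trans (left_eq_add.1 ((congrArg φ (add_zero 0)).symm.trans
            (hadd 0 0))).symm⟩
  | ht a c => exact ht a c
  | ha x y hx hy =>
    obtain ⟨x', hx'⟩ := hx
    obtain ⟨y', hy'⟩ := hy
    exact ⟨x' + y', by rw [map_add, hadd, hx', hy']⟩

lemma frame_tmul_one {β : G →* (B' ≃⋆ₐ[ℂ] B')} {n : ℕ} {e f : Fin n → B'}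
    (h : ∀ x, ∑ k, e k * covInner β (f k) x = x) (x : CStarTensor B' (compactsUnit H)) :
    ∑ k, tmul (e k) 1 * covInner (mapAction β (compactsUnit H)) (tmul (f k) 1) x = x := by
  induction x using induction_tmul with
  | hc =>
    refine isClosed_eq (continuous_finsetSum _ fun k _ => continuous_const.mul ?_) continuous_id
    exact continuous_covInner_right _ _
  | hz => exact Finset.sum_eq_zero fun k _ => by simp [covInner]
  | ht a c =>
    simp only [covInner_mapAction_tmul, tmul_mul_tmul, star_one, one_mul, ← sum_tmul, h]
  | ha x y hx hy => simp only [covInner_add_right, mul_add, Finset.sum_add_distrib, hx, hy]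

lemma injective_stabUnital (hH : ¬ FiniteDimensional ℂ H) {ρ : B →⋆ₐ[ℂ] B'}
    (hρ : Function.Injective ρ) : Function.Injective (stabUnital H ρ) :=
  injective_map_id_compactsUnit hH (f := (ρ : B →⋆ₙₐ[ℂ] B')) hρ

lemma sum_mapAction_mem_range_stabUnital (hH : ¬ FiniteDimensional ℂ H) {ρ : B →⋆ₐ[ℂ] B'}
    {β : G →* (B' ≃⋆ₐ[ℂ] B')} (hρ : Function.Injective ρ)
    (hrange : Set.range ρ = {b : B' | ∀ g : G, β g b = b})
    (x : CStarTensor B' (compactsUnit H)) :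
    ∑ g, mapAction β (compactsUnit H) g x ∈ Set.range (stabUnital H ρ) := by
  refine mem_range_of_forall_tmul
    (f := map (ρ : B →⋆ₙₐ[ℂ] B') (NonUnitalStarAlgHom.id ℂ (compactsUnit H)))
    (injective_stabUnital hH hρ) (continuous_finsetSum _ fun g _ => continuous_map _ _)
    (fun y z => ?_) (fun b c => ?_) x
  · rw [← Finset.sum_add_distrib]
    exact Finset.sum_congr rfl fun g _ => map_add (mapAction β (compactsUnit H) g) y z
  · have hb : ∑ g, β g b ∈ Set.range ρ := by
      rw [hrange]
      intro g
      rw [map_sum]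
      exact Fintype.sum_equiv (Equiv.mulLeft g) _ _ fun h => by simp
    obtain ⟨b', hb'⟩ := hb
    refine ⟨tmul b' c, ?_⟩
    simp only [map_tmul]
    exact (congrArg (tmul · c) hb').trans (sum_tmul _ _ _)

/-- A fixed point of the stabilised action is, up to the factor `|G|`, the sum over its orbit, and
the sum over `G` maps `b ⊗ c` to `(∑ g, g b) ⊗ c`. -/
lemma range_stabUnital (hH : ¬ FiniteDimensional ℂ H) {ρ : B →⋆ₐ[ℂ] B'}
    {β : G →* (B' ≃⋆ₐ[ℂ] B')} (hρ : Function.Injective ρ)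
    (hrange : Set.range ρ = {b : B' | ∀ g : G, β g b = b}) :
    Set.range (stabUnital H ρ) =
      {x | ∀ g : G, mapAction β (compactsUnit H) g x = x} := by
  refine Set.Subset.antisymm ?_ fun x hx => ?_
  · rintro _ ⟨x, rfl⟩ g
    change map _ _ (map _ _ x) = map _ _ x
    rw [map_comp_apply]
    congr 2
    ext b
    have hb : ρ b ∈ {b : B' | ∀ g : G, β g b = b} := hrange ▸ Set.mem_range_self b
    exact hb g
  · obtain ⟨y, hy⟩ := sum_mapAction_mem_range_stabUnital hH hρ hrange x
    have hsum : ∑ g, mapAction β (compactsUnit H) g x = (Fintype.card G : ℂ) • x := by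
      rw [Finset.sum_congr rfl fun g _ => hx g, Finset.sum_const, Finset.card_univ,
        Nat.cast_smul_eq_nsmul]
    refine ⟨(Fintype.card G : ℂ)⁻¹ • y, ?_⟩
    rw [map_smul, hy, hsum, smul_smul, inv_mul_cancel₀ (by simp), one_smul]

lemma isUnitalFiniteFoldCovering_stab (hH : ¬ FiniteDimensional ℂ H) {ρ : B →⋆ₐ[ℂ] B'}
    {β : G →* (B' ≃⋆ₐ[ℂ] B')} (h : IsUnitalFiniteFoldCovering ρ β) :
    IsUnitalFiniteFoldCovering (stabUnital H ρ) (mapAction β (compactsUnit H)) := by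
  obtain ⟨n, e, f, hframe⟩ := h.exists_frame
  have hinj := injective_stabUnital hH h.injective
  have hrange := range_stabUnital hH h.injective h.range_eq
  have hfp := finite_and_projective_of_frame hinj hrange (frame_tmul_one (H := H) hframe)
  refine ⟨hinj, fun g hg => ?_, hrange, hfp.1, hfp.2⟩
  obtain ⟨b, hb⟩ := h.nondegenerate g hg
  obtain ⟨u, hu⟩ := exists_orthonormal_nat hH
  refine ⟨tmul b 1, fun hb' => hb ?_⟩
  have h1 := congrArg (slice (u 0) (u 0)) hb'
  simpa [inner_self_eq_norm_sq_to_K, hu.1 0] using h1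

lemma inr_snd_mul_inr (c : compactsUnit H) (k : compacts H) :
    (((c * (k : compactsUnit H)).snd : compacts H) : compactsUnit H) = c * k := by
  ext <;> simp

lemma inr_snd_inr_mul (k : compacts H) (c : compactsUnit H) :
    ((((k : compactsUnit H) * c).snd : compacts H) : compactsUnit H) = k * c := by
  ext <;> simp

lemma mul_stabIncl_mem_range (hH : ¬ FiniteDimensional ℂ H) {i : A →⋆ₙₐ[ℂ] B}
    (h : IsEssentialIdeal i) (b : CStarTensor B (compactsUnit H))
    (a : CStarTensor A (compacts H)) : b * stabIncl H i a ∈ Set.range (stabIncl H i) := by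
  have hinj : Function.Injective (stabIncl H i) := injective_map_inr hH h.injective
  refine mem_range_of_forall_tmul hinj (φ := fun a => b * stabIncl H i a)
    (continuous_const.mul (continuous_map _ _))
    (fun x y => by rw [map_add, mul_add]) (fun a k => ?_) a
  refine mem_range_of_forall_tmul hinj (φ := fun b => b * stabIncl H i (tmul a k))
    (continuous_id.mul continuous_const) (fun x y => add_mul _ _ _) (fun b c => ?_) b
  obtain ⟨a', ha'⟩ := h.mul_mem_left b a
  refine ⟨tmul a' (c * (k : compactsUnit H)).snd, ?_⟩
  rw [map_tmul, map_tmul, tmul_mul_tmul, ha']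
  exact congrArg (tmul _) (inr_snd_mul_inr c k)

lemma stabIncl_mul_mem_range (hH : ¬ FiniteDimensional ℂ H) {i : A →⋆ₙₐ[ℂ] B}
    (h : IsEssentialIdeal i) (a : CStarTensor A (compacts H))
    (b : CStarTensor B (compactsUnit H)) : stabIncl H i a * b ∈ Set.range (stabIncl H i) := by
  have hinj : Function.Injective (stabIncl H i) := injective_map_inr hH h.injective
  refine mem_range_of_forall_tmul hinj (φ := fun a => stabIncl H i a * b)
    ((continuous_map _ _).mul continuous_const)
    (fun x y => by rw [map_add, add_mul]) (fun a k => ?_) a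
  refine mem_range_of_forall_tmul hinj (φ := fun b => stabIncl H i (tmul a k) * b)
    (continuous_const.mul continuous_id) (fun x y => mul_add _ _ _) (fun b c => ?_) b
  obtain ⟨a', ha'⟩ := h.mul_mem_right a b
  refine ⟨tmul a' ((k : compactsUnit H) * c).snd, ?_⟩
  rw [map_tmul, map_tmul, tmul_mul_tmul, ha']
  exact congrArg (tmul _) (inr_snd_inr_mul k c)

/-- If `x` annihilates `A ⊗ K`, its slices annihilate `A`, because for a
unit vector `u` the slice at `v, u` of `x (a ⊗ |w⟩⟨u|)` is the slice of `x` at `v, w` times `a`. -/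
lemma isEssentialIdeal_stabIncl (hH : ¬ FiniteDimensional ℂ H) {i : A →⋆ₙₐ[ℂ] B}
    (h : IsEssentialIdeal i) : IsEssentialIdeal (stabIncl H i) where
  injective := injective_map_inr hH h.injective
  mul_mem_left := mul_stabIncl_mem_range hH h
  mul_mem_right := stabIncl_mul_mem_range hH h
  essential b hb := by
    obtain ⟨u, hu⟩ := exists_orthonormal_nat hH
    refine eq_zero_of_slice_eq_zero hH fun v w => h.essential _ fun a => ?_
    have h1 := congrArg (slice v (u 0)) (hb (tmul a (compacts.rankOne w (u 0))))
    rw [map_tmul, slice_mul_tmul] at h1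
    simpa [inner_self_eq_norm_sq_to_K, hu.1 0] using h1

end CStarTensor

open CStarTensor

variable {A A' B B' G H : Type*} [NonUnitalCStarAlgebra A] [NonUnitalCStarAlgebra A']
  [CStarAlgebra B] [CStarAlgebra B'] [Group G] [Fintype G]
  [NormedAddCommGroup H] [InnerProductSpace ℂ H] [CompleteSpace H]

lemma covInner_stabIncl_tmul_mem_range {π : A →⋆ₙₐ[ℂ] A'}
    {α : G →* (A' ≃⋆ₐ[ℂ] A')} {i : A →⋆ₙₐ[ℂ] B} {j : A' →⋆ₙₐ[ℂ] B'} {ρ : B →⋆ₐ[ℂ] B'}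
    {β : G →* (B' ≃⋆ₐ[ℂ] B')} (h : IsCoveringVia π α i j ρ β)
    (b : B') (c : compactsUnit H) (a : A') (k : compacts H) :
    covInner (mapAction β (compactsUnit H)) (tmul b c) (stabIncl H j (tmul a k)) ∈
      Set.range (map ((ρ : B →⋆ₙₐ[ℂ] B').comp i)
        (Unitization.inrNonUnitalStarAlgHom ℂ (compacts H))) := by
  have hja : j a ∈ {x : B' | ∀ y : B', ∃ a : A, covInner β y x = ρ (i a)} :=
    h.range_eq ▸ Set.mem_range_self a
  obtain ⟨a', ha'⟩ := hja b
  refine ⟨tmul a' (star c * (k : compactsUnit H)).snd, ?_⟩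
  rw [map_tmul, map_tmul, covInner_mapAction_tmul, ha']
  exact congrArg (tmul _) (inr_snd_mul_inr (star c) k)

lemma covInner_stabIncl_mem_range (hH : ¬ FiniteDimensional ℂ H) {π : A →⋆ₙₐ[ℂ] A'}
    {α : G →* (A' ≃⋆ₐ[ℂ] A')} {i : A →⋆ₙₐ[ℂ] B} {j : A' →⋆ₙₐ[ℂ] B'} {ρ : B →⋆ₐ[ℂ] B'}
    {β : G →* (B' ≃⋆ₐ[ℂ] B')} (h : IsCoveringVia π α i j ρ β)
    (y : CStarTensor B' (compactsUnit H)) (x : CStarTensor A' (compacts H)) :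
    covInner (mapAction β (compactsUnit H)) y (stabIncl H j x) ∈
      Set.range (map ((ρ : B →⋆ₙₐ[ℂ] B').comp i)
        (Unitization.inrNonUnitalStarAlgHom ℂ (compacts H))) := by
  have hinj := injective_map_inr (H := H) hH (f := (ρ : B →⋆ₙₐ[ℂ] B').comp i)
    (h.covering.injective.comp h.essential_base.injective)
  have hy (a : A') (k : compacts H) (y : CStarTensor B' (compactsUnit H)) :=
    mem_range_of_forall_tmul hinj
      (φ := fun y => covInner (mapAction β (compactsUnit H)) y (stabIncl H j (tmul a k)))
      (continuous_covInner_left _ _)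
      (fun y y' => covInner_add_left _ y y' _)
      (fun b c => covInner_stabIncl_tmul_mem_range h b c a k) y
  exact mem_range_of_forall_tmul hinj
    (φ := fun x => covInner (mapAction β (compactsUnit H)) y (stabIncl H j x))
    ((continuous_covInner_right _ y).comp (continuous_map _ _))
    (fun x x' => (congrArg (covInner _ y) (map_add (stabIncl H j) x x')).trans
      (covInner_add_right _ y _ _)) (fun a k => hy a k y) x

/-- Stabilisation of a realised covering. An `x` with all `⟨y, x⟩` in `A ⊗ K` is a sum of products
`(e k ⊗ 1) * ⟨f k ⊗ 1, x⟩` by the frame expansion, hence lies in the ideal `A' ⊗ K`. -/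
lemma IsCoveringVia.stab (hH : ¬ FiniteDimensional ℂ H) {π : A →⋆ₙₐ[ℂ] A'}
    {α : G →* (A' ≃⋆ₐ[ℂ] A')} {i : A →⋆ₙₐ[ℂ] B} {j : A' →⋆ₙₐ[ℂ] B'} {ρ : B →⋆ₐ[ℂ] B'}
    {β : G →* (B' ≃⋆ₐ[ℂ] B')} (h : IsCoveringVia π α i j ρ β) :
    IsCoveringVia (stab H π) (mapAction α (compacts H)) (stabIncl H i) (stabIncl H j)
      (stabUnital H ρ) (mapAction β (compactsUnit H)) := by
  have hcompat (a : CStarTensor A (compacts H)) :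
      stabIncl H j (NCCov.stab H π a) = stabUnital H ρ (stabIncl H i a) := by
    rw [stabUnital_apply, map_comp_apply, map_comp_apply]
    congr 2
    ext a
    exact h.compatible a
  have hessA := isEssentialIdeal_stabIncl hH h.essential_base
  have hessA' := isEssentialIdeal_stabIncl hH h.essential_total
  have hcov := isUnitalFiniteFoldCovering_stab hH h.covering
  refine ⟨hcompat, fun g x => ?_, hessA, hessA', hcov, Set.Subset.antisymm ?_ fun x hx => ?_⟩
  · change map _ _ (map _ _ x) = map _ _ (map _ _ x)
    rw [map_comp_apply, map_comp_apply]
    congr 2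
    ext a
    exact h.equivariant g a
  · rintro _ ⟨x, rfl⟩ y
    obtain ⟨a, ha⟩ := covInner_stabIncl_mem_range hH h y x
    refine ⟨a, ha.symm.trans ?_⟩
    rw [stabUnital_apply, map_comp_apply]
    rfl
  · obtain ⟨n, e, f, hframe⟩ := h.covering.exists_frame
    rw [← frame_tmul_one (H := H) hframe x]
    refine Finset.sum_induction _ (· ∈ Set.range (stabIncl H j)) ?_ ⟨0, map_zero _⟩ fun k _ => ?_
    · rintro _ _ ⟨x', rfl⟩ ⟨y', rfl⟩
      exact ⟨x' + y', map_add _ _ _⟩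
    · obtain ⟨a, ha⟩ := hx (tmul (f k) 1)
      rw [ha, ← hcompat]
      exact hessA'.mul_mem_left _ _

end Stabilisation
end NCCov

theorem mainTheorem3 {A : Type u} {A' : Type v} {G : Type w} {H : Type t}
    [NonUnitalCStarAlgebra A] [NonUnitalCStarAlgebra A'] [Group G] [Fintype G]
    [NormedAddCommGroup H] [InnerProductSpace ℂ H] [CompleteSpace H]
    [TopologicalSpace.SeparableSpace H] (hH : ¬ FiniteDimensional ℂ H)
    (π : A →⋆ₙₐ[ℂ] A') (α : G →* (A' ≃⋆ₐ[ℂ] A'))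
    (h : NCCov.IsFiniteFoldCovering π α) :
    NCCov.IsFiniteFoldCovering (NCCov.stab H π)
        (NCCov.CStarTensor.mapAction α (NCCov.compacts H)) ∧
      ∀ (B : Type u) (B' : Type v) [CStarAlgebra B] [CStarAlgebra B']
        (i : A →⋆ₙₐ[ℂ] B) (j : A' →⋆ₙₐ[ℂ] B')
        (ρ : B →⋆ₐ[ℂ] B') (β : G →* (B' ≃⋆ₐ[ℂ] B')),
        NCCov.IsCoveringVia π α i j ρ β →
        NCCov.IsCoveringVia (NCCov.stab H π)
          (NCCov.CStarTensor.mapAction α (NCCov.compacts H))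
          (NCCov.stabIncl H i) (NCCov.stabIncl H j) (NCCov.stabUnital H ρ)
          (NCCov.CStarTensor.mapAction β (NCCov.compactsUnit H)) := by
  obtain ⟨B, B', _, _, i, j, ρ, β, hvia⟩ := h
  exact ⟨⟨_, _, inferInstance, inferInstance, _, _, _, _, hvia.stab hH⟩,
    fun _ _ _ _ _ _ _ _ hvia => hvia.stab hH⟩
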